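/- \textbf{Setting.} Write $\mathbb N=\{1,2,\dots\}$. Let $d_1,d_2\ge 0$ be integers and let $E(n)=O(n)\ltimes\mathbb R^n$ be the Euclidean group with $(A,b)(A',b')=(AA',b+Ab')$, $\operatorname{rot}(A,b)=A$, $\operatorname{trans}(A,b)=b$, acting on $\mathbb R^n$ by $(A,b)\cdot x=Ax+b$. Let $\mathcal S$ be a $d_2$-dimensional space group, i.e. a discrete subgroup of $E(d_2)$ that contains $d_2$ linearly independent translations, and let $\mathcal T_{\mathcal S}$ be its subgroup of translations. Let $\mathcal G$ be a discrete subgroup of $E(d_1+d_2)$ all of whose elements have the form $A\oplus g$ with $A\in O(d_1)$ and $g\in\mathcal S$ (where $A\oplus(B,b)$ has linear component $\operatorname{diag}(A,B)$ and translation component $(0,b)$), and suppose that $\pi(\mathcal G)=\mathcal S$, where $\pi(A\oplus g)=g$. Let $\mathcal F=\ker(\pi|_{\mathcal G})$ and let $\mathcal T\subset\mathcal G$ be a subset that $\pi$ maps bijectively onto $\mathcal T_{\mathcal S}$. Then $\mathcal T\mathcal F=\{tf: t\in\mathcal T,f\in\mathcal F\}$ is a normal subgroup of finite index in $\mathcal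 G$. For $n\in\mathbb N$ put $\mathcal T^n=\{t^n:t\in\mathcal T\}$, and let $M_0=\{n\in\mathbb N:\mathcal T^n\text{ is a normal subgroup of }\mathcal G\}$. Let $m\in\mathbb N$ be such that $M_0=m\mathbb N$. Representations are homomorphisms into the group $U(d_\rho)$ of unitary $d_\rho\times d_\rho$ matrices, $d_\rho\in\mathbb N$, considered up to unitary equivalence, and $\widehat{\mathcal T\mathcal F}$ is the set of equivalence classes of irreducible representations of $\mathcal T\mathcal F$. The group $\mathcal G$ acts by $(g\cdot\rho)(h)=\rho(g^{-1}hg)$; for $k\in\mathbb R^{d_2}$ let $\chi_k(h)=\exp(2\pi \mathrm i\langle k,\operatorname{trans}(\pi(h))\rangle)$ for $h\in\mathcal T\mathcal F$; and $\operatorname{Ind}=\operatorname{Ind}_{\mathcal T\mathcal F}^{\mathcal G}$ is the induced representation. On $\widehat{\mathcal T\mathcal F}$ let $\rho\sim\rho'$ mean that $g\cdot\rho=\chi_k\rho'$ for some $g\in\mathcal G$ and $k\in\mathbb R^{d_2}$. For $\rho\in\widehat{\mathcal T\mathcal F}$ let $\mathcal G_\rho\le E(d_2)$ be the group of all $(\operatorname{rot}(\pi(g)),k)$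 with $g\in\mathcal G$, $k\in\mathbb R^{d_2}$ and $g\cdot\rho=\chi_k\rho$. Let $L=\operatorname{trans}(\mathcal T_{\mathcal S})$, let $L^*=\{x\in\mathbb R^{d_2}:\langle x,y\rangle\in\mathbb Z\text{ for all }y\in L\}$ be its dual lattice, and let $L^*/N=\{k/N:k\in L^*\}$. \textbf{Theorem.} Let $R$ be a representation set of $\{\rho\in\widehat{\mathcal T\mathcal F}:\rho|_{\mathcal T^m}=I_{d_\rho}\}/{\sim}$, i.e. a subset of $\{\rho\in\widehat{\mathcal T\mathcal F}:\rho|_{\mathcal T^m}=I_{d_\rho}\}$ that contains exactly one element of each class of $\sim$ on that set. (i) The set $\{k/N:k\in L^*,N\in M_0\}$ is invariant under $\mathcal G_\rho$ for every $\rho\in R$, and the map \[\bigsqcup_{\rho\in R}\{k/N:k\in L^*,N\in M_0\}/\mathcal G_\rho\to\operatorname{Ind}\bigl(\{\rho\in\widehat{\mathcal T\mathcal F}:\exists N\in M_0,\ \rho|_{\mathcal T^N}=I_{d_\rho}\}\bigr),\qquad(\mathcal G_\rho\cdot k,\rho)\mapsto\operatorname{Ind}(\chi_k\rho)\] is well defined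 and bijective. (ii) For every $N\in M_0$ the set $L^*/N$ is invariant under $\mathcal G_\rho$ for every $\rho\in R$, and the map \[\bigsqcup_{\rho\in R}(L^*/N)/\mathcal G_\rho\to\operatorname{Ind}\bigl(\{\rho\in\widehat{\mathcal T\mathcal F}:\rho|_{\mathcal T^N}=I_{d_\rho}\}\bigr),\qquad(\mathcal G_\rho\cdot k,\rho)\mapsto\operatorname{Ind}(\chi_k\rho)\] is well defined and bijective. Here $X/\mathcal G_\rho$ is the set of orbits $\mathcal G_\rho\cdot k$, $k\in X$, $\bigsqcup$ is the disjoint union, and $\operatorname{Ind}(A)$ is the set of all $\operatorname{Ind}\rho$ with $\rho\in A$. -/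

import Mathlib

open scoped Matrix Pointwise

noncomputable section

/-! ## The Euclidean group -/

/-- An element `(A, b)` of the Euclidean group `E(ι) = O(ι) ⋉ ℝ^ι`. -/
@[ext]
structure EuclideanIsometry (ι : Type) [Fintype ι] [DecidableEq ι] where
  /-- the linear component `A` -/
  rot : Matrix.orthogonalGroup ι ℝ
  /-- the translation component `b` -/
  trans : EuclideanSpace ℝ ι

namespace EuclideanIsometry

variable {ι : Type} [Fintype ι] [DecidableEq ι]

/-- The product `A x` of an orthogonal matrix and a vector. -/
def mulVec (A : Matrix.orthogonalGroup ι ℝ) (x : EuclideanSpace ℝ ι) : EuclideanSpace ℝ ι :=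
  Matrix.toEuclideanLin (A : Matrix ι ι ℝ) x

theorem mulVec_one (x : EuclideanSpace ℝ ι) : mulVec 1 x = x := by
  simp [mulVec]

theorem mulVec_mul (A B : Matrix.orthogonalGroup ι ℝ) (x : EuclideanSpace ℝ ι) :
    mulVec (A * B) x = mulVec A (mulVec B x) := by
  simp [mulVec, Matrix.toLpLin_mul_same]

theorem mulVec_add (A : Matrix.orthogonalGroup ι ℝ) (x y : EuclideanSpace ℝ ι) :
    mulVec A (x + y) = mulVec A x + mulVec A y := by
  simp [mulVec]

theorem mulVec_neg (A : Matrix.orthogonalGroup ι ℝ) (x : EuclideanSpace ℝ ι) :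
    mulVec A (-x) = -mulVec A x := by
  simp [mulVec]

theorem inner_mulVec (A : Matrix.orthogonalGroup ι ℝ) (x y : EuclideanSpace ℝ ι) :
    inner ℝ (mulVec A x) y = inner ℝ x (mulVec A⁻¹ y) := by
  have h : ((A⁻¹ : Matrix.orthogonalGroup ι ℝ) : Matrix ι ι ℝ) = (A : Matrix ι ι ℝ)ᵀ := rfl
  simp only [mulVec, EuclideanSpace.inner_eq_star_dotProduct, h, Matrix.ofLp_toLpLin,
    Matrix.toLin'_apply, star_trivial]
  rw [Matrix.dotProduct_mulVec, Matrix.mulVec_transpose]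

theorem norm_mulVec (A : Matrix.orthogonalGroup ι ℝ) (x : EuclideanSpace ℝ ι) :
    ‖mulVec A x‖ = ‖x‖ := by
  rw [norm_eq_sqrt_real_inner, norm_eq_sqrt_real_inner x, inner_mulVec, ← mulVec_mul,
    inv_mul_cancel, mulVec_one]

theorem mulVec_zero (A : Matrix.orthogonalGroup ι ℝ) :
    mulVec A (0 : EuclideanSpace ℝ ι) = 0 := by
  simp [mulVec]

/-- The group law `(A₁, b₁)(A₂, b₂) = (A₁A₂, b₁ + A₁b₂)`. -/
instance : Group (EuclideanIsometry ι) where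
  mul g h := ⟨g.rot * h.rot, g.trans + mulVec g.rot h.trans⟩
  one := ⟨1, 0⟩
  inv g := ⟨g.rot⁻¹, -mulVec g.rot⁻¹ g.trans⟩
  mul_assoc a b c := EuclideanIsometry.ext (mul_assoc a.rot b.rot c.rot) (by
    change (a.trans + mulVec a.rot b.trans) + mulVec (a.rot * b.rot) c.trans
      = a.trans + mulVec a.rot (b.trans + mulVec b.rot c.trans)
    rw [mulVec_mul, mulVec_add, add_assoc])
  one_mul a := EuclideanIsometry.ext (one_mul a.rot) (by
    change (0 : EuclideanSpace ℝ ι) + mulVec 1 a.trans = a.trans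
    rw [mulVec_one, zero_add])
  mul_one a := EuclideanIsometry.ext (mul_one a.rot) (by
    change a.trans + mulVec a.rot 0 = a.trans
    rw [mulVec_zero, add_zero])
  inv_mul_cancel a := EuclideanIsometry.ext (inv_mul_cancel a.rot) (by
    change -mulVec a.rot⁻¹ a.trans + mulVec a.rot⁻¹ a.trans = 0
    rw [neg_add_cancel])

@[simp] theorem rot_mul (g h : EuclideanIsometry ι) : (g * h).rot = g.rot * h.rot := rfl
@[simp] theorem trans_mul (g h : EuclideanIsometry ι) :
    (g * h).trans = g.trans + mulVec g.rot h.trans := rfl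
@[simp] theorem rot_one : (1 : EuclideanIsometry ι).rot = 1 := rfl
@[simp] theorem trans_one : (1 : EuclideanIsometry ι).trans = 0 := rfl
@[simp] theorem rot_inv (g : EuclideanIsometry ι) : (g⁻¹).rot = g.rot⁻¹ := rfl
@[simp] theorem trans_inv (g : EuclideanIsometry ι) :
    (g⁻¹).trans = -mulVec g.rot⁻¹ g.trans := rfl

/-- The natural action `(A, b) • x = A x + b` on `ℝ^ι`. -/
instance : MulAction (EuclideanIsometry ι) (EuclideanSpace ℝ ι) where
  smul g x := mulVec g.rot x + g.trans
  one_smul x := by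
    change mulVec 1 x + 0 = x
    rw [mulVec_one, add_zero]
  mul_smul g h x := by
    change mulVec (g.rot * h.rot) x + (g.trans + mulVec g.rot h.trans)
      = mulVec g.rot (mulVec h.rot x + h.trans) + g.trans
    rw [mulVec_mul, mulVec_add]; abel

/-- The subspace topology of `ℝ^(ι × ι) × ℝ^ι`. -/
instance : TopologicalSpace (EuclideanIsometry ι) :=
  TopologicalSpace.induced
    (fun g => ((g.rot : Matrix ι ι ℝ), g.trans)) inferInstance

/-- The linear component as a group homomorphism `E(ι) → O(ι)`. -/
def rotHom : EuclideanIsometry ι →* Matrix.orthogonalGroup ι ℝ where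
  toFun := rot
  map_one' := rfl
  map_mul' _ _ := rfl

end EuclideanIsometry

open EuclideanIsometry

/-- The Euclidean group `E(n)`. -/
abbrev Euc (n : ℕ) : Type := EuclideanIsometry (Fin n)

/-- The subgroup of translations of a group of Euclidean isometries. -/
def translationSubgroup {ι : Type} [Fintype ι] [DecidableEq ι]
    (S : Subgroup (EuclideanIsometry ι)) : Subgroup (EuclideanIsometry ι) :=
  S ⊓ (rotHom (ι := ι)).ker

/-- An `n`-dimensional space group: a discrete subgroup of `E(n)` that contains `n` linearly
independent translations. -/
structure IsSpaceGroup {n : ℕ} (S : Subgroup (Euc n)) : Prop where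
  discrete : DiscreteTopology S
  exists_translations : ∃ t : Fin n → Euc n,
    (∀ i, t i ∈ translationSubgroup S) ∧ LinearIndependent ℝ (fun i => (t i).trans)

theorem IsSpaceGroup.finite_rot {n : ℕ} {S : Subgroup (Euc n)} (hS : IsSpaceGroup S) :
    (rotHom '' (S : Set (Euc n))).Finite := by
  obtain ⟨hd, t, ht, hli⟩ := hS
  let L : AddSubgroup (EuclideanSpace ℝ (Fin n)) :=
    { carrier := {x | (⟨1, x⟩ : Euc n) ∈ S}
      zero_mem' := S.one_mem
      add_mem' := fun {x y} hx hy => by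
        have h := S.mul_mem hx hy
        have e : (⟨1, x⟩ * ⟨1, y⟩ : Euc n) = ⟨1, x + y⟩ :=
          EuclideanIsometry.ext (one_mul _) (by rw [trans_mul, mulVec_one])
        rwa [e] at h
      neg_mem' := fun {x} hx => by
        have h := S.inv_mem hx
        have e : (⟨1, x⟩ : Euc n)⁻¹ = ⟨1, -x⟩ :=
          EuclideanIsometry.ext inv_one (by rw [trans_inv, inv_one, mulVec_one])
        rwa [e] at h }
  have hLd : DiscreteTopology L := by
    refine DiscreteTopology.of_continuous_injective
      (f := fun x : L => (⟨⟨1, x.1⟩, x.2⟩ : S)) ?_ ?_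
    · refine Continuous.subtype_mk (continuous_induced_rng.2 ?_) _
      exact continuous_const.prodMk continuous_subtype_val
    · intro x y hxy
      exact Subtype.ext (congrArg (fun z : S => z.1.trans) hxy)
  have hLc : IsClosed (L : Set (EuclideanSpace ℝ (Fin n))) := AddSubgroup.isClosed_of_discrete
  have hfin : ∀ i, (Metric.closedBall (0 : EuclideanSpace ℝ (Fin n)) ‖(t i).trans‖ ∩ L).Finite :=
    fun i => Metric.finite_isBounded_inter_isClosed ⟨hLd⟩ Metric.isBounded_closedBall hLc
  refine Set.Finite.of_injOn (f := fun A i => mulVec A (t i).trans)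
    (t := Set.pi Set.univ fun i =>
      Metric.closedBall (0 : EuclideanSpace ℝ (Fin n)) ‖(t i).trans‖ ∩ L) ?_ ?_
    (Set.Finite.pi hfin)
  · rintro _ ⟨g, hg, rfl⟩ i _
    refine ⟨by simp [norm_mulVec], ?_⟩
    have h := S.mul_mem (S.mul_mem hg (ht i).1) (S.inv_mem hg)
    have hr : (t i).rot = 1 := (ht i).2
    have e : g * t i * g⁻¹ = ⟨1, mulVec g.rot (t i).trans⟩ := by
      refine EuclideanIsometry.ext (by simp [hr]) ?_
      simp only [trans_mul, rot_mul, trans_inv, hr, mul_one, mulVec_neg, ← mulVec_mul,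
        mul_inv_cancel, mulVec_one]
      abel
    rw [e] at h
    exact h
  · intro A _ B _ hAB
    have hsp := hli.span_eq_top_of_card_eq_finrank' (by simp)
    have : Matrix.toEuclideanLin (A : Matrix (Fin n) (Fin n) ℝ)
        = Matrix.toEuclideanLin (B : Matrix (Fin n) (Fin n) ℝ) := by
      refine LinearMap.ext_on hsp ?_
      rintro _ ⟨i, rfl⟩
      exact congrFun hAB i
    exact Subtype.ext (Matrix.toEuclideanLin.injective this)

/-- The block-diagonal sum `O(d₁) × E(d₂) → E(d₁ + d₂)`,
`(A₁, (A₂, b₂)) ↦ ((A₁ 0; 0 A₂), (0, b₂))`. The coordinates of `ℝ^(d₁ + d₂)` are indexed by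
`Fin d₁ ⊕ Fin d₂`. -/
def blockSum (d₁ d₂ : ℕ) :
    Matrix.orthogonalGroup (Fin d₁) ℝ × Euc d₂ →* EuclideanIsometry (Fin d₁ ⊕ Fin d₂) where
  toFun p :=
    { rot := ⟨Matrix.fromBlocks (p.1 : Matrix (Fin d₁) (Fin d₁) ℝ) 0 0
          (p.2.rot : Matrix (Fin d₂) (Fin d₂) ℝ), by
        rw [Matrix.mem_orthogonalGroup_iff,
          Matrix.fromBlocks_transpose, Matrix.fromBlocks_multiply]
        have h1 := (Matrix.mem_orthogonalGroup_iff _ _).1 p.1.2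
        have h2 := (Matrix.mem_orthogonalGroup_iff _ _).1 p.2.rot.2
        simp [h1, h2]⟩
      trans := WithLp.toLp 2 (Sum.elim (fun _ => 0) p.2.trans.ofLp) }
  map_one' := by
    refine EuclideanIsometry.ext (Subtype.ext ?_) ?_
    · simp
    · ext i; rcases i with i | i <;> simp
  map_mul' p q := by
    refine EuclideanIsometry.ext (Subtype.ext ?_) ?_
    · simp [Matrix.fromBlocks_multiply]
    · ext i
      rcases i with i | i <;>
        simp [mulVec, Matrix.mulVec, dotProduct, Fintype.sum_sum_type]

theorem blockSum_injective (d₁ d₂ : ℕ) : Function.Injective (blockSum d₁ d₂) := by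
  rintro ⟨A, g⟩ ⟨B, h⟩ hgh
  have h1 := congrArg (fun x => (x.rot : Matrix (Fin d₁ ⊕ Fin d₂) (Fin d₁ ⊕ Fin d₂) ℝ)) hgh
  have h2 := congrArg (fun x => x.trans) hgh
  have h3 := Matrix.fromBlocks_inj.1 h1
  refine Prod.ext (Subtype.ext h3.1) (EuclideanIsometry.ext (Subtype.ext h3.2.2.2) ?_)
  ext i
  have := congrArg (fun x => x (Sum.inr i)) h2
  simpa [blockSum] using this

/-- The natural homomorphism `O(d₁) ⊕ E(d₂) → E(d₂)`, `A ⊕ g ↦ g`. -/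
def blockProj (d₁ d₂ : ℕ) : (blockSum d₁ d₂).range →* Euc d₂ :=
  (MonoidHom.snd _ _).comp (MonoidHom.ofInjective (blockSum_injective d₁ d₂)).symm.toMonoidHom

theorem blockProj_blockSum (d₁ d₂ : ℕ) (p : Matrix.orthogonalGroup (Fin d₁) ℝ × Euc d₂) :
    blockProj d₁ d₂ ⟨blockSum d₁ d₂ p, ⟨p, rfl⟩⟩ = p.2 := by
  have : (MonoidHom.ofInjective (blockSum_injective d₁ d₂)).symm
      ⟨blockSum d₁ d₂ p, ⟨p, rfl⟩⟩ = p := by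
    rw [MulEquiv.symm_apply_eq]; rfl
  simp [blockProj, this]

/-! ## Unitary representations, dual space and induced representations -/

/-- A (finite-dimensional, unitary) representation `ρ : H → U(d_ρ)` with `d_ρ ≥ 1`. -/
structure URep (H : Type) [Group H] where
  dim : ℕ
  dim_pos : 0 < dim
  hom : H →* Matrix.unitaryGroup (Fin dim) ℂ

namespace URep

variable {H : Type} [Group H]

/-- The matrix `ρ(g)`. -/
def mat (ρ : URep H) (g : H) : Matrix (Fin ρ.dim) (Fin ρ.dim) ℂ := (ρ.hom g : Matrix _ _ ℂ)

/-- Unitary equivalence: `d_ρ = d_ρ'` and `Tᴴ ρ(g) T = ρ'(g)` for all `g`, for some unitary `T`. -/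
def Equivalent (ρ ρ' : URep H) : Prop :=
  ρ.dim = ρ'.dim ∧ ∃ T : Matrix (Fin ρ.dim) (Fin ρ'.dim) ℂ,
    Tᴴ * T = 1 ∧ T * Tᴴ = 1 ∧ ∀ g, Tᴴ * ρ.mat g * T = ρ'.mat g

theorem Equivalent.refl (ρ : URep H) : ρ.Equivalent ρ :=
  ⟨rfl, 1, by simp, by simp, by simp⟩

theorem Equivalent.symm {ρ ρ' : URep H} (h : ρ.Equivalent ρ') : ρ'.Equivalent ρ := by
  obtain ⟨hd, T, h1, h2, h3⟩ := h
  refine ⟨hd.symm, Tᴴ, by simpa using h2, by simpa using h1, fun g => ?_⟩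
  rw [← h3 g, Matrix.conjTranspose_conjTranspose]
  calc T * (Tᴴ * ρ.mat g * T) * Tᴴ = (T * Tᴴ) * ρ.mat g * (T * Tᴴ) := by
        simp only [Matrix.mul_assoc]
    _ = ρ.mat g := by rw [h2]; simp

theorem Equivalent.trans {ρ ρ' ρ'' : URep H} (h : ρ.Equivalent ρ') (h' : ρ'.Equivalent ρ'') :
    ρ.Equivalent ρ'' := by
  obtain ⟨hd, T, h1, h2, h3⟩ := h
  obtain ⟨hd', U, k1, k2, k3⟩ := h'
  refine ⟨hd.trans hd', T * U, ?_, ?_, fun g => ?_⟩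
  · rw [Matrix.conjTranspose_mul]
    calc Uᴴ * Tᴴ * (T * U) = Uᴴ * ((Tᴴ * T) * U) := by simp only [Matrix.mul_assoc]
      _ = 1 := by rw [h1, Matrix.one_mul, k1]
  · rw [Matrix.conjTranspose_mul]
    calc T * U * (Uᴴ * Tᴴ) = T * ((U * Uᴴ) * Tᴴ) := by simp only [Matrix.mul_assoc]
      _ = 1 := by rw [k2, Matrix.one_mul, h2]
  · rw [← k3 g, ← h3 g, Matrix.conjTranspose_mul]
    simp only [Matrix.mul_assoc]

instance setoid (H : Type) [Group H] : Setoid (URep H) :=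
  ⟨Equivalent, Equivalent.refl, Equivalent.symm, Equivalent.trans⟩

/-- `ρ` is irreducible: the only invariant subspaces of `ℂ^d_ρ` are `{0}` and `ℂ^d_ρ`. -/
def IsIrreducible (ρ : URep H) : Prop :=
  ∀ W : Submodule ℂ (Fin ρ.dim → ℂ), (∀ g, ∀ v ∈ W, ρ.mat g *ᵥ v ∈ W) → W = ⊥ ∨ W = ⊤

/-- The representation `h ↦ ρ(φ(h))`. -/
def comp {H' : Type} [Group H'] (ρ : URep H) (φ : H' →* H) : URep H' :=
  ⟨ρ.dim, ρ.dim_pos, ρ.hom.comp φ⟩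

/-- The product `χρ` of a one-dimensional representation `χ` and a representation `ρ`. -/
def twist (χ : H →* Circle) (ρ : URep H) : URep H where
  dim := ρ.dim
  dim_pos := ρ.dim_pos
  hom :=
    { toFun := fun g => ⟨(χ g : ℂ) • ρ.mat g, by
        have h := (Matrix.mem_unitaryGroup_iff).1 (ρ.hom g).2
        rw [Matrix.mem_unitaryGroup_iff, star_smul, smul_mul_smul_comm, mat, h]
        have hc : (χ g : ℂ) * star (χ g : ℂ) = 1 := by
          rw [Complex.star_def, Complex.mul_conj, Circle.normSq_coe]; simp
        rw [hc, one_smul]⟩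
      map_one' := Subtype.ext (by simp [mat])
      map_mul' := fun g h => Subtype.ext (by
        simp [mat, smul_smul, mul_comm]) }

/-- A homomorphism into the unitary matrices indexed by an arbitrary non-empty finite type, viewed
as a representation through a numbering of that type. -/
def ofFintype {κ : Type} [Fintype κ] [DecidableEq κ] [Nonempty κ]
    (f : H →* Matrix.unitaryGroup κ ℂ) : URep H where
  dim := Fintype.card κ
  dim_pos := Fintype.card_pos
  hom :=
    { toFun := fun g => ⟨Matrix.reindex (Fintype.equivFin κ) (Fintype.equivFin κ)
          (f g : Matrix κ κ ℂ), by
        have h := (Matrix.mem_unitaryGroup_iff).1 (f g).2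
        rw [Matrix.star_eq_conjTranspose] at h
        rw [Matrix.mem_unitaryGroup_iff, Matrix.star_eq_conjTranspose,
          Matrix.conjTranspose_reindex, Matrix.reindex_apply, Matrix.reindex_apply,
          Matrix.submatrix_mul_equiv, h, Matrix.submatrix_one_equiv]⟩
      map_one' := Subtype.ext (by simp)
      map_mul' := fun g h => Subtype.ext (by simp [Matrix.submatrix_mul_equiv]) }

open Classical in
/-- `ρ` extended by zero: `ρ̇(g) = ρ(g)` for `g ∈ K` and `ρ̇(g) = 0` otherwise. -/
def dot {K : Subgroup H} (ρ : URep K) (g : H) : Matrix (Fin ρ.dim) (Fin ρ.dim) ℂ :=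
  if h : g ∈ K then ρ.mat ⟨g, h⟩ else 0

/-- The block matrix `(ρ̇(h_i⁻¹ g h_j))_{i,j}`, where `h_i` runs through a set of representatives of
the left cosets of `K` in `H`. -/
def indMat {K : Subgroup H} (ρ : URep K) (g : H) :
    Matrix ((H ⧸ K) × Fin ρ.dim) ((H ⧸ K) × Fin ρ.dim) ℂ :=
  Matrix.of fun p q => ρ.dot (p.1.out⁻¹ * g * q.1.out) p.2 q.2


open Classical in
theorem dot_mul_of_mem {K : Subgroup H} (ρ : URep K) (g h : H) (hh : h ∈ K) :
    ρ.dot g * ρ.dot h = ρ.dot (g * h) := by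
  by_cases hg : g ∈ K
  · have h1 : ρ.mat ⟨g * h, K.mul_mem hg hh⟩ = ρ.mat ⟨g, hg⟩ * ρ.mat ⟨h, hh⟩ := by
      rw [mat, mat, mat, ← Matrix.UnitaryGroup.mul_val, ← map_mul]; rfl
    simp only [dot, hg, hh, K.mul_mem hg hh, dif_pos, h1]
  · have : g * h ∉ K := fun h' => hg ((K.mul_mem_cancel_right hh).1 h')
    simp [dot, hg, this]

open Classical in
theorem dot_of_notMem {K : Subgroup H} (ρ : URep K) (g : H) (hg : g ∉ K) : ρ.dot g = 0 := by
  simp [dot, hg]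

open Classical in
theorem dot_inv {K : Subgroup H} (ρ : URep K) (g : H) : ρ.dot g⁻¹ = (ρ.dot g)ᴴ := by
  by_cases hg : g ∈ K
  · have : (⟨g⁻¹, K.inv_mem hg⟩ : K) = ⟨g, hg⟩⁻¹ := rfl
    simp only [dot, hg, K.inv_mem hg, dif_pos, this, mat, map_inv]
    rfl
  · have : g⁻¹ ∉ K := fun h => hg (by simpa using K.inv_mem h)
    simp [dot, hg, this]

theorem coset_out_mem_iff {K : Subgroup H} (p : H ⧸ K) (g : H) :
    p.out⁻¹ * g ∈ K ↔ p = (g : H ⧸ K) := by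
  rw [← QuotientGroup.eq, QuotientGroup.out_eq']

open Classical in
theorem indMat_mul {K : Subgroup H} [Fintype (H ⧸ K)] (ρ : URep K) (g h : H) :
    ρ.indMat g * ρ.indMat h = ρ.indMat (g * h) := by
  ext ⟨p, a⟩ ⟨q, b⟩
  have key : ∀ r : H ⧸ K, ∑ c, ρ.dot (p.out⁻¹ * g * r.out) a c * ρ.dot (r.out⁻¹ * h * q.out) c b
      = if r = ((h * q.out : H) : H ⧸ K) then ρ.dot (p.out⁻¹ * (g * h) * q.out) a b else 0 := by
    intro r
    rw [← Matrix.mul_apply]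
    have hmem := coset_out_mem_iff r (h * q.out)
    rw [← mul_assoc] at hmem
    split_ifs with hr
    · rw [dot_mul_of_mem _ _ _ (hmem.2 hr)]
      have : p.out⁻¹ * g * r.out * (r.out⁻¹ * h * q.out) = p.out⁻¹ * (g * h) * q.out := by group
      rw [this]
    · rw [dot_of_notMem _ (r.out⁻¹ * h * q.out) (fun h' => hr (hmem.1 h'))]
      simp
  rw [Matrix.mul_apply, Fintype.sum_prod_type]
  simp only [indMat, Matrix.of_apply]
  rw [Finset.sum_congr rfl (fun r _ => key r)]
  simp

open Classical in
theorem indMat_one {K : Subgroup H} (ρ : URep K) : ρ.indMat 1 = 1 := by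
  ext ⟨p, a⟩ ⟨q, b⟩
  simp only [indMat, Matrix.of_apply, mul_one]
  by_cases hpq : p = q
  · subst hpq
    have h1 : (⟨1, K.one_mem⟩ : K) = 1 := rfl
    simp [dot, K.one_mem, h1, mat, Matrix.one_apply]
  · rw [dot_of_notMem]
    · simp [hpq]
    · rw [coset_out_mem_iff, QuotientGroup.out_eq']; exact hpq

theorem indMat_inv {K : Subgroup H} (ρ : URep K) (g : H) : ρ.indMat g⁻¹ = (ρ.indMat g)ᴴ := by
  ext ⟨p, a⟩ ⟨q, b⟩
  simp only [indMat, Matrix.of_apply, Matrix.conjTranspose_apply]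
  rw [← Matrix.conjTranspose_apply, ← dot_inv]
  congr 2; group

open Classical in
/-- The homomorphism `g ↦ (ρ̇(h_i⁻¹ g h_j))_{i,j}`. -/
def indHom {K : Subgroup H} [Fintype (H ⧸ K)] (ρ : URep K) :
    H →* Matrix.unitaryGroup ((H ⧸ K) × Fin ρ.dim) ℂ where
  toFun g := ⟨ρ.indMat g, by
    rw [Matrix.mem_unitaryGroup_iff, Matrix.star_eq_conjTranspose, ← indMat_inv, indMat_mul,
      mul_inv_cancel, indMat_one]⟩
  map_one' := Subtype.ext ρ.indMat_one
  map_mul' g h := Subtype.ext (ρ.indMat_mul g h).symm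

open Classical in
/-- The induced representation `Ind_K^H ρ` for a subgroup `K` of finite index in `H`. -/
def ind {K : Subgroup H} [K.FiniteIndex] (ρ : URep K) : URep H :=
  letI : Fintype (H ⧸ K) := Fintype.ofFinite _
  haveI : Nonempty (Fin ρ.dim) := ⟨⟨0, ρ.dim_pos⟩⟩
  ofFintype ρ.indHom

theorem Equivalent.comp {H' : Type} [Group H'] {ρ ρ' : URep H} (h : ρ.Equivalent ρ')
    (φ : H' →* H) : (ρ.comp φ).Equivalent (ρ'.comp φ) := by
  obtain ⟨hd, T, h1, h2, h3⟩ := h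
  exact ⟨hd, T, h1, h2, fun g => h3 (φ g)⟩

theorem mat_twist (χ : H →* Circle) (ρ : URep H) (g : H) :
    (ρ.twist χ).mat g = (χ g : ℂ) • ρ.mat g := rfl

theorem Equivalent.twist {ρ ρ' : URep H} (h : ρ.Equivalent ρ') (χ : H →* Circle) :
    (ρ.twist χ).Equivalent (ρ'.twist χ) := by
  obtain ⟨hd, T, h1, h2, h3⟩ := h
  refine ⟨hd, T, h1, h2, fun g => ?_⟩
  rw [mat_twist, mat_twist, ← h3 g]
  exact (congrArg (· * T) (Matrix.mul_smul Tᴴ (χ g : ℂ) (ρ.mat g))).trans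
    (Matrix.smul_mul (χ g : ℂ) _ T)

theorem equivalent_mk {d d' : ℕ} {hd : 0 < d} {hd' : 0 < d'}
    (f : H →* Matrix.unitaryGroup (Fin d) ℂ) (f' : H →* Matrix.unitaryGroup (Fin d') ℂ)
    (h : d = d') (T : Matrix (Fin d) (Fin d') ℂ) (h1 : Tᴴ * T = 1) (h2 : T * Tᴴ = 1)
    (h3 : ∀ g, Tᴴ * (f g : Matrix (Fin d) (Fin d) ℂ) * T = (f' g : Matrix (Fin d') (Fin d') ℂ)) :
    Equivalent ⟨d, hd, f⟩ ⟨d', hd', f'⟩ := ⟨h, T, h1, h2, h3⟩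

theorem equivalent_ofFintype {κ κ' : Type} [Fintype κ] [DecidableEq κ] [Nonempty κ]
    [Fintype κ'] [DecidableEq κ'] [Nonempty κ']
    (f : H →* Matrix.unitaryGroup κ ℂ) (f' : H →* Matrix.unitaryGroup κ' ℂ)
    (hc : Fintype.card κ = Fintype.card κ') (U : Matrix κ κ' ℂ) (h1 : Uᴴ * U = 1)
    (h2 : U * Uᴴ = 1)
    (h3 : ∀ g, Uᴴ * (f g : Matrix κ κ ℂ) * U = (f' g : Matrix κ' κ' ℂ)) :
    (ofFintype f).Equivalent (ofFintype f') := by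
  refine equivalent_mk _ _ hc (U.submatrix (Fintype.equivFin κ).symm (Fintype.equivFin κ').symm)
    ?_ ?_ fun g => ?_
  · rw [Matrix.conjTranspose_submatrix, Matrix.submatrix_mul_equiv, h1, Matrix.submatrix_one_equiv]
  · rw [Matrix.conjTranspose_submatrix, Matrix.submatrix_mul_equiv, h2, Matrix.submatrix_one_equiv]
  · change _ * Matrix.submatrix (f g : Matrix κ κ ℂ) (Fintype.equivFin κ).symm
        (Fintype.equivFin κ).symm * _
      = Matrix.submatrix (f' g : Matrix κ' κ' ℂ) (Fintype.equivFin κ').symm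
        (Fintype.equivFin κ').symm
    rw [← h3 g, Matrix.conjTranspose_submatrix, Matrix.submatrix_mul_equiv,
      Matrix.submatrix_mul_equiv]

theorem mk_congr {d : ℕ} {hd : 0 < d} {f f' : H →* Matrix.unitaryGroup (Fin d) ℂ}
    (h : ∀ g, (f g : Matrix (Fin d) (Fin d) ℂ) = f' g) :
    (⟨d, hd, f⟩ : URep H) = ⟨d, hd, f'⟩ := by
  rw [MonoidHom.ext fun g => Subtype.ext (h g)]

open Classical in
theorem Equivalent.ind {K : Subgroup H} [K.FiniteIndex] {ρ ρ' : URep K} (h : ρ.Equivalent ρ') :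
    ρ.ind.Equivalent ρ'.ind := by
  obtain ⟨hd, T, h1, h2, h3⟩ := h
  let _ : Fintype (H ⧸ K) := Fintype.ofFinite _
  have : Nonempty (Fin ρ.dim) := ⟨⟨0, ρ.dim_pos⟩⟩
  have : Nonempty (Fin ρ'.dim) := ⟨⟨0, ρ'.dim_pos⟩⟩
  have hdot : ∀ g : H, ρ'.dot g = Tᴴ * ρ.dot g * T := by
    intro g
    by_cases hg : g ∈ K
    · simp [dot, hg, h3]
    · simp [dot, hg]
  refine equivalent_ofFintype ρ.indHom ρ'.indHom (by simp [hd])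
    (Matrix.kroneckerMap (· * ·) (1 : Matrix (H ⧸ K) (H ⧸ K) ℂ) T) ?_ ?_ fun g => ?_
  · rw [Matrix.conjTranspose_kronecker, ← Matrix.mul_kronecker_mul, h1]
    simp
  · rw [Matrix.conjTranspose_kronecker, ← Matrix.mul_kronecker_mul, h2]
    simp
  · change _ * ρ.indMat g * _ = ρ'.indMat g
    ext ⟨p, a⟩ ⟨q, b⟩
    simp only [indMat, Matrix.of_apply, hdot]
    simp only [Matrix.mul_apply, Fintype.sum_prod_type, Matrix.one_apply, Finset.sum_mul,
      Matrix.conjTranspose_apply, Matrix.kroneckerMap_apply, ite_mul, one_mul, zero_mul, mul_ite,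
      mul_zero, apply_ite star, star_zero, Matrix.of_apply]
    rw [Finset.sum_eq_single q (by
      intro r _ hr
      simp [hr]) (by simp)]
    refine Finset.sum_congr rfl fun x _ => ?_
    rw [Finset.sum_eq_single p (by
      intro r _ hr
      simp [hr]) (by simp)]
    simp

end URep

/-- The equivalence classes of representations of `H`. -/
abbrev RepClass (H : Type) [Group H] : Type := Quotient (URep.setoid H)

namespace RepClass

variable {H : Type} [Group H]

/-- The dual space of `H`: the set of all equivalence classes of irreducible representations. -/
def dual (H : Type) [Group H] : Set (RepClass H) :=
  {c | ∃ ρ : URep H, ρ.IsIrreducible ∧ (⟦ρ⟧ : RepClass H) = c}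

/-- The action `(g · ρ)(n) = ρ(g⁻¹ n g)` of `H` on the classes of representations of a normal
subgroup `N`. -/
def conj {N : Subgroup H} [N.Normal] (g : H) : RepClass N → RepClass N :=
  Quotient.map (fun ρ => ρ.comp (MulAut.conjNormal g⁻¹ : MulAut N).toMonoidHom)
    fun _ _ h => URep.Equivalent.comp h _

/-- Multiplication by a one-dimensional representation. -/
def twist (χ : H →* Circle) : RepClass H → RepClass H :=
  Quotient.map (fun ρ => ρ.twist χ) fun _ _ h => URep.Equivalent.twist h χ

/-- The induced representation of a class is the class of the induced representation. -/
def ind {K : Subgroup H} [K.FiniteIndex] : RepClass K → RepClass H :=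
  Quotient.map (fun ρ => ρ.ind) fun _ _ h => URep.Equivalent.ind h

/-- `ρ(h)` is the identity matrix for every `h ∈ A`. -/
def TrivialOn (A : Set H) : RepClass H → Prop :=
  Quotient.lift (fun ρ : URep H => ∀ h ∈ A, ρ.mat h = 1) (by
    have aux : ∀ ρ ρ' : URep H, ρ.Equivalent ρ' → (∀ h ∈ A, ρ.mat h = 1) →
        ∀ h ∈ A, ρ'.mat h = 1 := by
      rintro ρ ρ' ⟨_, T, h1, _, h3⟩ hρ h hh
      rw [← h3 h, hρ h hh, Matrix.mul_one, h1]
    intro ρ ρ' h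
    exact propext ⟨aux ρ ρ' h, aux ρ' ρ (URep.Equivalent.symm h)⟩)

theorem conj_one {N : Subgroup H} [N.Normal] (c : RepClass N) : conj 1 c = c := by
  induction c using Quotient.inductionOn with
  | h ρ => exact congrArg (Quotient.mk _) (URep.mk_congr fun n => by simp)

theorem conj_mul {N : Subgroup H} [N.Normal] (g h : H) (c : RepClass N) :
    conj (g * h) c = conj g (conj h c) := by
  induction c using Quotient.inductionOn with
  | h ρ => exact congrArg (Quotient.mk _) (URep.mk_congr fun n => by
    simp [URep.comp]; rfl)

theorem twist_one (c : RepClass H) : twist 1 c = c := by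
  induction c using Quotient.inductionOn with
  | h ρ => exact congrArg (Quotient.mk _) (URep.mk_congr fun n => by simp [URep.mat])

theorem twist_mul (χ χ' : H →* Circle) (c : RepClass H) :
    twist (χ * χ') c = twist χ (twist χ' c) := by
  induction c using Quotient.inductionOn with
  | h ρ =>
    exact congrArg (Quotient.mk _) (URep.mk_congr fun n => mul_smul (χ n : ℂ) (χ' n : ℂ) (ρ.mat n))

theorem conj_twist {N : Subgroup H} [N.Normal] (g : H) (χ : N →* Circle) (c : RepClass N) :
    conj g (twist χ c)
      = twist (χ.comp (MulAut.conjNormal g⁻¹ : MulAut N).toMonoidHom) (conj g c) := by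
  induction c using Quotient.inductionOn with
  | h ρ => rfl

end RepClass

/-! ## Discrete groups of isometries -/

/-- A `d₂`-dimensional space group `S`, a discrete subgroup `G` of `O(d₁) ⊕ S` inside `E(d₁ + d₂)`
with `π(G) = S`, and a subset `T` of `G` that `π` maps bijectively onto the group of translations
of `S`. Here `π(A ⊕ g) = g`. -/
structure DiscreteIsometryGroup (d₁ d₂ : ℕ) where
  G : Subgroup (EuclideanIsometry (Fin d₁ ⊕ Fin d₂))
  discrete : DiscreteTopology G
  le_range : G ≤ (blockSum d₁ d₂).range
  S : Subgroup (Euc d₂)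
  isSpaceGroup : IsSpaceGroup S
  range_proj : ((blockProj d₁ d₂).comp (Subgroup.inclusion le_range)).range = S
  T : Set G
  bijOn_proj : Set.BijOn ((blockProj d₁ d₂).comp (Subgroup.inclusion le_range)) T
    (translationSubgroup S)

namespace DiscreteIsometryGroup

variable {d₁ d₂ : ℕ} (D : DiscreteIsometryGroup d₁ d₂)

/-- The homomorphism `π : G → E(d₂)`, with image `S`. -/
def pi : D.G →* Euc d₂ := (blockProj d₁ d₂).comp (Subgroup.inclusion D.le_range)

/-- The kernel `F` of `π` on `G`. -/
def F : Subgroup D.G := D.pi.ker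

theorem pi_mem (g : D.G) : D.pi g ∈ D.S := by
  rw [← D.range_proj]; exact ⟨g, rfl⟩

theorem bijOn_pi : Set.BijOn D.pi D.T (translationSubgroup D.S) := D.bijOn_proj

theorem T_mul_F : D.T * (D.F : Set D.G) = ((translationSubgroup D.S).comap D.pi : Set D.G) := by
  ext g
  rw [Set.mem_mul]
  constructor
  · rintro ⟨t, ht, f, hf, rfl⟩
    change D.pi (t * f) ∈ translationSubgroup D.S
    rw [map_mul, show D.pi f = 1 from hf, mul_one]
    exact D.bijOn_pi.mapsTo ht
  · intro hg
    obtain ⟨t, ht, htg⟩ := D.bijOn_pi.surjOn hg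
    refine ⟨t, ht, t⁻¹ * g, ?_, by group⟩
    change D.pi (t⁻¹ * g) = 1
    rw [map_mul, map_inv, htg, inv_mul_cancel]

/-- The subgroup `TF` of all products `tf`. -/
def TF : Subgroup D.G :=
  ((translationSubgroup D.S).comap D.pi).copy (D.T * (D.F : Set D.G)) D.T_mul_F

theorem TF_eq : D.TF = (rotHom.comp D.pi).ker := by
  rw [TF, Subgroup.copy_eq]
  ext g
  change (D.pi g ∈ D.S ∧ (D.pi g).rot = 1) ↔ (D.pi g).rot = 1
  exact ⟨fun h => h.2, fun h => ⟨D.pi_mem g, h⟩⟩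

theorem mem_TF {g : D.G} : g ∈ D.TF ↔ (D.pi g).rot = 1 := by
  rw [TF_eq]; rfl

instance : D.TF.Normal := by
  rw [TF_eq]; infer_instance

instance : D.TF.FiniteIndex := by
  have hfin : Finite (rotHom.comp D.pi).range := by
    refine (D.isSpaceGroup.finite_rot.subset ?_).to_subtype
    rintro _ ⟨g, rfl⟩
    exact ⟨D.pi g, D.pi_mem g, rfl⟩
  rw [TF_eq]
  infer_instance

/-- The set `T^n = {t^n | t ∈ T}` of `n`-th powers. -/
def powT (n : ℕ) : Set D.G := (fun t => t ^ n) '' D.T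

theorem powT_subset_TF (n : ℕ) : D.powT n ⊆ D.TF := by
  rintro _ ⟨t, ht, rfl⟩
  exact D.TF.pow_mem (D.mem_TF.2 (D.bijOn_pi.mapsTo ht).2) n

/-- The set `M` of all positive integers `m` such that `T^m` is a normal subgroup of `G`. -/
def M : Set ℕ := {m | 0 < m ∧ ∃ N : Subgroup D.G, N.Normal ∧ (N : Set D.G) = D.powT m}

/-- The lattice `L = trans(T_S)` of translation vectors of `S`. -/
def L : Set (EuclideanSpace ℝ (Fin d₂)) := trans '' (translationSubgroup D.S : Set (Euc d₂))

/-- The dual lattice `L* = {x | ⟨x, y⟩ ∈ ℤ for all y ∈ L}`. -/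
def dualL : Set (EuclideanSpace ℝ (Fin d₂)) := {x | ∀ y ∈ D.L, ∃ z : ℤ, inner ℝ x y = z}

/-- The set `L*/N = {k/N | k ∈ L*}`. -/
def dualLDiv (N : ℕ) : Set (EuclideanSpace ℝ (Fin d₂)) := {x | ∃ k ∈ D.dualL, x = (N : ℝ)⁻¹ • k}

/-- The one-dimensional representation `χ_k(g) = exp(2πi⟨k, trans(π(g))⟩)` of `TF`. -/
def chi (k : EuclideanSpace ℝ (Fin d₂)) : D.TF →* Circle where
  toFun g := Circle.exp (2 * Real.pi * inner ℝ k ((D.pi g).trans))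
  map_one' := by simp
  map_mul' g h := by
    have hg : (D.pi g).rot = 1 := D.mem_TF.1 g.2
    rw [← Circle.exp_add, Subgroup.coe_mul, map_mul D.pi, trans_mul, hg, mulVec_one,
      inner_add_right, mul_add]

theorem chi_zero : D.chi 0 = 1 := by
  ext g; simp [chi]

theorem chi_add (k l : EuclideanSpace ℝ (Fin d₂)) : D.chi (k + l) = D.chi k * D.chi l := by
  refine MonoidHom.ext fun g => ?_
  simp [chi, inner_add_left, mul_add, Circle.exp_add]

theorem chi_conj (g : D.G) (k : EuclideanSpace ℝ (Fin d₂)) :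
    (D.chi k).comp (MulAut.conjNormal g⁻¹ : MulAut D.TF).toMonoidHom
      = D.chi (mulVec (D.pi g).rot k) := by
  refine MonoidHom.ext fun h => ?_
  have hh : (D.pi h).rot = 1 := D.mem_TF.1 h.2
  have key : (D.pi (g⁻¹ * h * g)).trans = mulVec (D.pi g).rot⁻¹ (D.pi h).trans := by
    simp only [map_mul, map_inv, trans_mul, rot_mul, trans_inv, rot_inv, hh, mul_one]
    abel
  change Circle.exp (2 * Real.pi * inner ℝ k ((D.pi ((MulAut.conjNormal g⁻¹ : MulAut D.TF) h)).trans))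
    = Circle.exp (2 * Real.pi * inner ℝ (mulVec (D.pi g).rot k) ((D.pi h).trans))
  rw [inner_mulVec, ← key, MulAut.conjNormal_apply, inv_inv]

/-- The product `χ_k ρ`. -/
def chiMul (k : EuclideanSpace ℝ (Fin d₂)) (ρ : RepClass D.TF) : RepClass D.TF :=
  RepClass.twist (D.chi k) ρ

/-- The relation `ρ ∼ ρ'`: there are `g ∈ G` and `k ∈ ℝ^d₂` with `g · ρ = χ_k ρ'`. -/
def Rel (ρ ρ' : RepClass D.TF) : Prop :=
  ∃ (g : D.G) (k : EuclideanSpace ℝ (Fin d₂)), RepClass.conj g ρ = D.chiMul k ρ'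

/-- `R` is a representation set of `A/∼`: it consists of elements of `A`, and each element of `A`
is related to exactly one element of `R`. -/
def IsRepresentationSet (R A : Set (RepClass D.TF)) : Prop :=
  R ⊆ A ∧ ∀ ρ ∈ A, ∃! r, r ∈ R ∧ D.Rel ρ r

theorem conj_chiMul (g : D.G) (k : EuclideanSpace ℝ (Fin d₂)) (ρ : RepClass D.TF) :
    RepClass.conj g (D.chiMul k ρ) = D.chiMul (mulVec (D.pi g).rot k) (RepClass.conj g ρ) := by
  rw [chiMul, RepClass.conj_twist, chi_conj]; rfl

theorem chiMul_chiMul (k l : EuclideanSpace ℝ (Fin d₂)) (ρ : RepClass D.TF) :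
    D.chiMul k (D.chiMul l ρ) = D.chiMul (k + l) ρ := by
  rw [chiMul, chiMul, chiMul, chi_add, RepClass.twist_mul]

theorem chiMul_zero (ρ : RepClass D.TF) : D.chiMul 0 ρ = ρ := by
  rw [chiMul, chi_zero, RepClass.twist_one]

/-- The group `G_ρ = {(rot(π(g)), k) | g ∈ G, k ∈ ℝ^d₂, g · ρ = χ_k ρ}`. -/
def Grho (ρ : RepClass D.TF) : Subgroup (Euc d₂) where
  carrier := {x | ∃ (g : D.G) (k : EuclideanSpace ℝ (Fin d₂)),
    RepClass.conj g ρ = D.chiMul k ρ ∧ x = ⟨(D.pi g).rot, k⟩}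
  one_mem' := ⟨1, 0, by rw [RepClass.conj_one, chiMul_zero], by rw [map_one]; rfl⟩
  mul_mem' := by
    rintro _ _ ⟨g, k, hg, rfl⟩ ⟨h, l, hh, rfl⟩
    refine ⟨g * h, k + mulVec (D.pi g).rot l, ?_, ?_⟩
    · rw [RepClass.conj_mul, hh, conj_chiMul, hg, chiMul_chiMul, add_comm]
    · rw [map_mul]; rfl
  inv_mem' := by
    rintro _ ⟨g, k, hg, rfl⟩
    refine ⟨g⁻¹, -mulVec (D.pi g).rot⁻¹ k, ?_, ?_⟩
    · have h1 : ρ = D.chiMul (mulVec (D.pi g⁻¹).rot k) (RepClass.conj g⁻¹ ρ) := by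
        rw [← conj_chiMul, ← hg, ← RepClass.conj_mul, inv_mul_cancel, RepClass.conj_one]
      conv_rhs => rw [h1]
      rw [chiMul_chiMul, map_inv, rot_inv, neg_add_cancel, chiMul_zero]
    · rw [map_inv]; rfl

/-- The set `X/G_ρ` of the orbits `G_ρ · k`, `k ∈ X`. -/
def orbitSpace (ρ : RepClass D.TF) (X : Set (EuclideanSpace ℝ (Fin d₂))) :
    Set (Set (EuclideanSpace ℝ (Fin d₂))) :=
  (fun k => MulAction.orbit (D.Grho ρ) k) '' X

/-- The set of all `ρ` in the dual space of `TF` that are trivial on `T^N`. -/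
def periodicDual (N : ℕ) : Set (RepClass D.TF) :=
  {ρ | ρ ∈ RepClass.dual D.TF ∧ RepClass.TrivialOn {h : D.TF | (h : D.G) ∈ D.powT N} ρ}

/-- The set `X` is invariant under `G_ρ` for every `ρ ∈ R`, and
`(G_ρ · k, ρ) ↦ Ind(χ_k ρ)` is a well-defined bijection from the disjoint union of the orbit spaces
`X/G_ρ`, `ρ ∈ R`, onto the set of the induced representations `Ind(ρ)`, `ρ ∈ A`. -/
def LabelsInduced (R : Set (RepClass D.TF)) (X : Set (EuclideanSpace ℝ (Fin d₂)))
    (A : Set (RepClass D.TF)) : Prop :=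
  (∀ ρ ∈ R, ∀ g ∈ D.Grho ρ, ∀ k ∈ X, g • k ∈ X) ∧
  ∃ Φ : (Σ ρ : R, D.orbitSpace ρ X) → (RepClass.ind '' A : Set (RepClass D.G)),
    (∀ (ρ : R) (k : EuclideanSpace ℝ (Fin d₂)) (hk : k ∈ X),
      (Φ ⟨ρ, ⟨MulAction.orbit (D.Grho ρ) k, Set.mem_image_of_mem _ hk⟩⟩ : RepClass D.G)
        = RepClass.ind (D.chiMul k ρ)) ∧
    Function.Bijective Φ

end DiscreteIsometryGroup

end

/-! Two facts carry the theorem. The first is Clifford theory for the normal subgroup `TF` of finite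
index. Conjugate representations induce equivalent ones. Conversely, an induced representation
restricted to `TF` is block diagonal with conjugates as blocks, so by Schur's lemma a non-zero block
of an intertwiner makes a conjugate of one irreducible equivalent to a conjugate of the other. Hence
the fibres of `Ind` on the dual are exactly the `G`-orbits (`RepClass.ind_eq_ind_iff`); the induced
representations need not be irreducible.

The second is that twisting by some `χ_l` makes any irreducible representation of `TF` trivial on
`T^m` (`exists_trivialOn_chiMul`). The normal subgroup `T^m` is central in `TF`, so it acts by a
character; `π` identifies `T^m` with the lattice `mL`, and every character of a lattice is `x ↦
exp(2πi⟨l, x⟩)`. So every irreducible is conjugate to some `χ_k r` with `r ∈ R`.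

Since `g · (χ_k r) = χ_{Ak} (g · r)` with `A = rot(π(g))`, this equals `χ_{k'} r'` exactly when `g ·
r = χ_{k' - Ak} r'`. That forces `r = r'`, and `(A, k' - Ak)` is then an element of `G_r` carrying
`k` to `k'` (`ind_chiMul_eq_iff`). Finally, `r` is trivial on `T^N ⊆ T^m` for `N ∈ M_0`, so `χ_k r`
is trivial on `T^N` exactly when `χ_k` is, that is, when `k ∈ L*/N`. -/

noncomputable section

open EuclideanIsometry

/-! ### Schur's lemma for unitary matrix representations. -/

namespace URep

variable {H : Type} [Group H]

theorem mat_mul (ρ : URep H) (g h : H) : ρ.mat (g * h) = ρ.mat g * ρ.mat h := by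
  rw [mat, map_mul]; rfl

theorem mat_one (ρ : URep H) : ρ.mat 1 = 1 := by
  rw [mat, map_one]; rfl

theorem mat_inv (ρ : URep H) (g : H) : ρ.mat g⁻¹ = (ρ.mat g)ᴴ := by
  rw [mat, map_inv]; rfl

theorem eq_one_of_smul_one_eq_one {ρ : URep H} {c : ℂ}
    (h : c • (1 : Matrix (Fin ρ.dim) (Fin ρ.dim) ℂ) = 1) : c = 1 := by
  have := congrFun (congrFun h ⟨0, ρ.dim_pos⟩) ⟨0, ρ.dim_pos⟩
  simpa using this

/-- Schur's lemma: a matrix commuting with an irreducible representation is scalar. -/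
theorem IsIrreducible.exists_eq_smul_one {ρ : URep H} (hρ : ρ.IsIrreducible)
    (X : Matrix (Fin ρ.dim) (Fin ρ.dim) ℂ) (hX : ∀ g, X * ρ.mat g = ρ.mat g * X) :
    ∃ c : ℂ, X = c • 1 := by
  have : Nonempty (Fin ρ.dim) := ⟨⟨0, ρ.dim_pos⟩⟩
  obtain ⟨c, hc⟩ := Module.End.exists_eigenvalue (Matrix.toLin' X)
  refine ⟨c, ?_⟩
  have h := hρ (Module.End.eigenspace (Matrix.toLin' X) c) fun g v hv => by
    rw [Module.End.mem_eigenspace_iff, Matrix.toLin'_apply] at hv ⊢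
    rw [Matrix.mulVec_mulVec, hX, ← Matrix.mulVec_mulVec, hv, Matrix.mulVec_smul]
  rcases h with h | h
  · exact absurd h hc
  · refine Matrix.toLin'.injective (LinearMap.ext fun v => ?_)
    have hv : v ∈ Module.End.eigenspace (Matrix.toLin' X) c := by rw [h]; trivial
    rw [Module.End.mem_eigenspace_iff] at hv
    rw [hv]
    simp

open scoped ComplexOrder in
/-- Schur's lemma: irreducible representations with a non-zero intertwiner are equivalent. -/
theorem IsIrreducible.equivalent_of_intertwiner {ρ ρ' : URep H} (hρ : ρ.IsIrreducible)
    (hρ' : ρ'.IsIrreducible) (X : Matrix (Fin ρ.dim) (Fin ρ'.dim) ℂ) (hX0 : X ≠ 0)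
    (hX : ∀ g, ρ.mat g * X = X * ρ'.mat g) : ρ.Equivalent ρ' := by
  have hne : Matrix.toLin' X ≠ 0 := by simpa using hX0
  have hker : LinearMap.ker (Matrix.toLin' X) = ⊥ := by
    refine (hρ' _ fun g v hv => ?_).resolve_right fun h => hne (LinearMap.ker_eq_top.1 h)
    rw [LinearMap.mem_ker, Matrix.toLin'_apply] at hv ⊢
    rw [Matrix.mulVec_mulVec, ← hX, ← Matrix.mulVec_mulVec, hv, Matrix.mulVec_zero]
  have hran : LinearMap.range (Matrix.toLin' X) = ⊤ := by
    refine (hρ _ ?_).resolve_left fun h => hne (LinearMap.range_eq_bot.1 h)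
    rintro g _ ⟨w, rfl⟩
    refine ⟨ρ'.mat g *ᵥ w, ?_⟩
    rw [Matrix.toLin'_apply, Matrix.toLin'_apply, Matrix.mulVec_mulVec, Matrix.mulVec_mulVec, hX]
  have hd : ρ.dim = ρ'.dim := by
    have := (LinearEquiv.ofBijective _
      ⟨LinearMap.ker_eq_bot.1 hker, LinearMap.range_eq_top.1 hran⟩).finrank_eq
    simpa using this.symm
  -- By unitarity, the adjoint of the relation at `g⁻¹` says that `Xᴴ` intertwines in the other
  -- direction.
  have hX' : ∀ g, Xᴴ * ρ.mat g = ρ'.mat g * Xᴴ := fun g => by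
    have h := congrArg Matrix.conjTranspose (hX g⁻¹)
    rw [Matrix.conjTranspose_mul, Matrix.conjTranspose_mul, mat_inv, mat_inv,
      Matrix.conjTranspose_conjTranspose, Matrix.conjTranspose_conjTranspose] at h
    exact h
  -- Both products of `X` and `Xᴴ` are scalar. Below, the two scalars are shown to agree and to be a
  -- positive real `r`, so `X / √r` is unitary.
  obtain ⟨c, hc⟩ := hρ'.exists_eq_smul_one (Xᴴ * X) fun g => by
    rw [Matrix.mul_assoc, ← hX, ← Matrix.mul_assoc, hX', Matrix.mul_assoc]
  obtain ⟨d, hdc⟩ := hρ.exists_eq_smul_one (X * Xᴴ) fun g => by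
    rw [Matrix.mul_assoc, hX', ← Matrix.mul_assoc, ← hX, Matrix.mul_assoc]
  let i : Fin ρ'.dim := ⟨0, ρ'.dim_pos⟩
  -- A diagonal entry of `Xᴴ * X` is the squared norm of a column of `X`.
  have hcr : c = ((∑ j, Complex.normSq (X j i) : ℝ) : ℂ) := by
    have h := congrFun (congrFun hc i) i
    rw [Matrix.mul_apply] at h
    simp only [Matrix.conjTranspose_apply, Matrix.smul_apply, Matrix.one_apply_eq, smul_eq_mul,
      mul_one] at h
    rw [← h]
    push_cast
    exact Finset.sum_congr rfl fun j _ => by rw [Complex.normSq_eq_conj_mul_self]; rfl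
  set r : ℝ := ∑ j, Complex.normSq (X j i) with hr
  have hr0 : 0 ≤ r := Finset.sum_nonneg fun j _ => Complex.normSq_nonneg _
  have hXX : X * (Xᴴ * X) = c • X := by rw [hc]; simp
  have hcd : d = c := by
    have h1 : (d - c) • X = 0 := by
      rw [sub_smul, ← hXX, ← Matrix.mul_assoc, hdc]; simp
    exact sub_eq_zero.1 ((smul_eq_zero.1 h1).resolve_right hX0)
  have hc0 : c ≠ 0 := by
    intro h0
    rw [h0, zero_smul] at hc
    exact hX0 (Matrix.conjTranspose_mul_self_eq_zero.1 hc)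
  have hrpos : 0 < r := lt_of_le_of_ne hr0 fun h => hc0 (by rw [hcr, ← h]; simp)
  have hs : (((Real.sqrt r)⁻¹ : ℝ) : ℂ) * (((Real.sqrt r)⁻¹ : ℝ) : ℂ) * c = 1 := by
    rw [hcr, ← Complex.ofReal_mul, ← Complex.ofReal_mul, ← mul_inv, Real.mul_self_sqrt hr0,
      inv_mul_cancel₀ hrpos.ne', Complex.ofReal_one]
  have hst : star (((Real.sqrt r)⁻¹ : ℝ) : ℂ) = (((Real.sqrt r)⁻¹ : ℝ) : ℂ) :=
    Complex.conj_ofReal _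
  refine ⟨hd, (((Real.sqrt r)⁻¹ : ℝ) : ℂ) • X, ?_, ?_, fun g => ?_⟩
  · rw [Matrix.conjTranspose_smul, hst, Matrix.smul_mul, Matrix.mul_smul, hc, smul_smul, smul_smul,
      hs, one_smul]
  · rw [Matrix.conjTranspose_smul, hst, Matrix.smul_mul, Matrix.mul_smul, hdc, hcd, smul_smul,
      smul_smul, hs, one_smul]
  · rw [Matrix.conjTranspose_smul, hst, Matrix.mul_assoc, Matrix.mul_smul, hX, Matrix.smul_mul,
      Matrix.mul_smul, ← Matrix.mul_assoc, hc, Matrix.smul_mul, Matrix.one_mul, smul_smul,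
      smul_smul, hs, one_smul]

theorem IsIrreducible.comp {H' : Type} [Group H'] {ρ : URep H} (hρ : ρ.IsIrreducible)
    {φ : H' →* H} (hφ : Function.Surjective φ) : (ρ.comp φ).IsIrreducible := fun W hW =>
  hρ W fun g v hv => by
    obtain ⟨g', rfl⟩ := hφ g
    exact hW g' v hv

/-- Non-zero scalars do not affect which subspaces are invariant. -/
theorem IsIrreducible.twist {ρ : URep H} (hρ : ρ.IsIrreducible) (χ : H →* Circle) :
    (ρ.twist χ).IsIrreducible := fun W hW =>
  hρ W fun g v hv => by
    have h := W.smul_mem (χ g : ℂ)⁻¹ (hW g v hv)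
    have e : (χ g : ℂ)⁻¹ • (((χ g : ℂ) • ρ.mat g) *ᵥ v) = ρ.mat g *ᵥ v := by
      rw [Matrix.smul_mulVec, smul_smul, inv_mul_cancel₀ (Circle.coe_ne_zero _), one_smul]
    rw [← e]
    exact h

/-! ### Clifford theory: induction from a normal subgroup of finite index. -/

open Classical in
/-- `∑ r, ρ̇(x r) ρ̇(r⁻¹ y) = ρ̇(x y)`, where `r` runs through representatives of the left cosets. -/
theorem sum_dot_mul_dot {K : Subgroup H} [Fintype (H ⧸ K)] (ρ : URep K) (x y : H) :
    ∑ r : H ⧸ K, ρ.dot (x * r.out) * ρ.dot (r.out⁻¹ * y) = ρ.dot (x * y) := by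
  -- Only the representative of the coset `yK` gives a non-zero second factor.
  rw [Finset.sum_eq_single (y : H ⧸ K)]
  · rw [dot_mul_of_mem _ _ _ ((coset_out_mem_iff _ _).2 rfl)]
    congr 1; group
  · intro r _ hr
    rw [dot_of_notMem ρ (r.out⁻¹ * y) fun h => hr ((coset_out_mem_iff _ _).1 h), mul_zero]
  · simp

/-- Normality makes membership in `K` invariant under conjugation, so extension by zero commutes
with conjugating the representation. -/
theorem dot_conj {K : Subgroup H} [K.Normal] (ρ : URep K) (g x : H) :
    (ρ.comp (MulAut.conjNormal g⁻¹ : MulAut K).toMonoidHom).dot x = ρ.dot (g⁻¹ * x * g) := by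
  have hiff : g⁻¹ * x * g ∈ K ↔ x ∈ K := by
    simpa using (Subgroup.Normal.mem_comm_iff (H := K) ‹_› (a := g⁻¹ * x) (b := g))
  by_cases hx : x ∈ K
  · have e : (MulAut.conjNormal g⁻¹ : MulAut K) ⟨x, hx⟩ = ⟨g⁻¹ * x * g, hiff.2 hx⟩ :=
      Subtype.ext (by simp)
    rw [dot, dot, dif_pos hx, dif_pos (hiff.2 hx), ← e]
    rfl
  · exact (dot_of_notMem _ _ hx).trans (dot_of_notMem ρ _ fun h => hx (hiff.1 h)).symm

open Classical in
/-- Conjugate representations induce equivalent representations. -/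
theorem ind_conj {K : Subgroup H} [K.Normal] [K.FiniteIndex] (ρ : URep K) (g : H) :
    ρ.ind.Equivalent (ρ.comp (MulAut.conjNormal g⁻¹ : MulAut K).toMonoidHom).ind := by
  let _ : Fintype (H ⧸ K) := Fintype.ofFinite _
  have : Nonempty (Fin ρ.dim) := ⟨⟨0, ρ.dim_pos⟩⟩
  set ρ' := ρ.comp (MulAut.conjNormal g⁻¹ : MulAut K).toMonoidHom with hρ'
  have : Nonempty (Fin ρ'.dim) := ⟨⟨0, ρ'.dim_pos⟩⟩
  -- By normality the elements `h_q g` again represent the left cosets, and inducing `ρ` along them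
  -- gives the block matrix of the conjugate representation along the `h_q`. `U` is the change of
  -- representatives.
  let U : Matrix ((H ⧸ K) × Fin ρ.dim) ((H ⧸ K) × Fin ρ.dim) ℂ :=
    Matrix.of fun p q => ρ.dot (p.1.out⁻¹ * (q.1.out * g)) p.2 q.2
  have hUH : Uᴴ = Matrix.of fun p q => ρ.dot ((g⁻¹ * p.1.out⁻¹) * q.1.out) p.2 q.2 := by
    ext ⟨p, a⟩ ⟨q, b⟩
    simp only [U, Matrix.conjTranspose_apply, Matrix.of_apply]
    rw [← Matrix.conjTranspose_apply, ← dot_inv]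
    congr 2; group
  have hmul : ∀ h : H, ρ.indMat h * U
      = Matrix.of fun p q => ρ.dot (p.1.out⁻¹ * (h * q.1.out * g)) p.2 q.2 := by
    intro h
    ext ⟨p, a⟩ ⟨q, b⟩
    have e : p.out⁻¹ * (h * q.out * g) = (p.out⁻¹ * h) * (q.out * g) := by group
    rw [Matrix.mul_apply, Fintype.sum_prod_type]
    simp only [indMat, U, Matrix.of_apply]
    rw [e, ← sum_dot_mul_dot, Matrix.sum_apply]
    exact Finset.sum_congr rfl fun r _ => by rw [Matrix.mul_apply]
  have hmul' : ∀ h : H, Uᴴ * (ρ.indMat h * U) = ρ'.indMat h := by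
    intro h
    rw [hmul, hUH]
    ext ⟨p, a⟩ ⟨q, b⟩
    have e : g⁻¹ * (p.out⁻¹ * h * q.out) * g = (g⁻¹ * p.out⁻¹) * (h * q.out * g) := by group
    rw [Matrix.mul_apply, Fintype.sum_prod_type]
    refine Eq.trans ?_ (congrFun (congrFun (dot_conj ρ g _).symm a) b)
    simp only [Matrix.of_apply]
    rw [e, ← sum_dot_mul_dot, Matrix.sum_apply]
    exact Finset.sum_congr rfl fun r _ => by rw [Matrix.mul_apply]
  -- Unitarity is the intertwining identity at the identity element.
  have h1 : Uᴴ * U = 1 := by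
    have := hmul' 1
    rw [indMat_one, indMat_one, Matrix.one_mul] at this
    exact this
  exact equivalent_ofFintype ρ.indHom ρ'.indHom rfl U h1 (mul_eq_one_comm.1 h1) fun h =>
    (Matrix.mul_assoc _ _ _).trans (hmul' h)

-- For `n ∈ K`, normality shows that `h_p⁻¹ n h_q ∈ K` only if `h_p K = h_q K`. The restriction to
-- `K` is thus the direct sum of the conjugates of `ρ` by the coset representatives.
open Classical in
theorem indMat_coe {K : Subgroup H} [K.Normal] (ρ : URep K) (n : K) (p q : H ⧸ K)
    (a b : Fin ρ.dim) : ρ.indMat (n : H) (p, a) (q, b)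
      = if p = q then ρ.dot (p.out⁻¹ * n * p.out) a b else 0 := by
  change ρ.dot (p.out⁻¹ * n * q.out) a b = _
  split_ifs with h
  · subst h
    rfl
  · rw [dot_of_notMem]
    · rfl
    · intro h'
      have h2 : p.out⁻¹ * q.out ∈ K := by
        have h3 := K.mul_mem ((inferInstance : K.Normal).conj_mem _ (K.inv_mem n.2) p.out⁻¹) h'
        convert h3 using 1
        group
      rw [coset_out_mem_iff, QuotientGroup.out_eq'] at h2
      exact h h2

theorem mat_conj {K : Subgroup H} [K.Normal] (ρ : URep K) (g : H) (n : K) :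
    (ρ.comp (MulAut.conjNormal g⁻¹ : MulAut K).toMonoidHom).mat n = ρ.dot (g⁻¹ * n * g) := by
  rw [← dot_conj, dot, dif_pos n.2]

open Classical in
/-- Irreducible representations that induce equivalent representations are conjugate. -/
theorem exists_conj_of_ind_equivalent {K : Subgroup H} [K.Normal] [K.FiniteIndex] {ρ ρ' : URep K}
    (hρ : ρ.IsIrreducible) (hρ' : ρ'.IsIrreducible) (h : ρ.ind.Equivalent ρ'.ind) :
    ∃ g g' : H, (ρ.comp (MulAut.conjNormal g⁻¹ : MulAut K).toMonoidHom).Equivalent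
      (ρ'.comp (MulAut.conjNormal g'⁻¹ : MulAut K).toMonoidHom) := by
  let _ : Fintype (H ⧸ K) := Fintype.ofFinite _
  obtain ⟨-, T, h1, h2, h3⟩ := h
  let e : (H ⧸ K) × Fin ρ.dim ≃ Fin ρ.ind.dim := Fintype.equivFin _
  let e' : (H ⧸ K) × Fin ρ'.dim ≃ Fin ρ'.ind.dim := Fintype.equivFin _
  let X : Matrix ((H ⧸ K) × Fin ρ.dim) ((H ⧸ K) × Fin ρ'.dim) ℂ := T.submatrix e e'
  have hX : ∀ g, ρ.indMat g * X = X * ρ'.indMat g := by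
    intro g
    have h4 : ρ.ind.mat g * T = T * ρ'.ind.mat g := by
      rw [← h3, ← Matrix.mul_assoc, ← Matrix.mul_assoc, h2, Matrix.one_mul]
    have h5 : ρ.indMat g = (ρ.ind.mat g).submatrix e e := by
      change _ = (Matrix.reindex e e (ρ.indMat g)).submatrix e e
      simp
    have h6 : ρ'.indMat g = (ρ'.ind.mat g).submatrix e' e' := by
      change _ = (Matrix.reindex e' e' (ρ'.indMat g)).submatrix e' e'
      simp
    rw [h5, h6, Matrix.submatrix_mul_equiv, Matrix.submatrix_mul_equiv, h4]
  have hT : T ≠ 0 := by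
    rintro rfl
    have := congrFun (congrFun h1 ⟨0, ρ'.ind.dim_pos⟩) ⟨0, ρ'.ind.dim_pos⟩
    simp at this
  -- A non-zero block `(p, q)` of the intertwiner is, over `K`, an intertwiner between the
  -- conjugates by `h_p` and `h_q`. These are irreducible, so Schur's lemma applies.
  have hex : ∃ p q a b, X (p, a) (q, b) ≠ 0 := by
    by_contra! hall
    refine hT (Matrix.ext fun i j => ?_)
    have := hall (e.symm i).1 (e'.symm j).1 (e.symm i).2 (e'.symm j).2
    simpa [X] using this
  obtain ⟨p, q, a, b, hab⟩ := hex
  refine ⟨p.out, q.out, (hρ.comp (MulEquiv.surjective _)).equivalent_of_intertwiner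
    (hρ'.comp (MulEquiv.surjective _)) (Matrix.of fun i j => X (p, i) (q, j))
    (fun h0 => hab (congrFun (congrFun h0 a) b)) fun n => ?_⟩
  have h7 : ρ.dot (p.out⁻¹ * n * p.out) * (Matrix.of fun i j => X (p, i) (q, j))
      = (Matrix.of fun i j => X (p, i) (q, j)) * ρ'.dot (q.out⁻¹ * n * q.out) := by
    ext i j
    have h8 := congrFun (congrFun (hX n) (p, i)) (q, j)
    simp only [Matrix.mul_apply, Fintype.sum_prod_type, indMat_coe, ite_mul, zero_mul, mul_ite,
      mul_zero] at h8
    rw [Finset.sum_eq_single p (by intro r _ hr; simp [hr.symm]) (by simp),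
      Finset.sum_eq_single q (by intro r _ hr; simp [hr]) (by simp)] at h8
    simpa [Matrix.mul_apply] using h8
  rw [mat_conj, mat_conj]
  exact h7

end URep

/-! ### Fibres of induction, and triviality on a subset, for equivalence classes. -/

namespace RepClass

variable {H : Type} [Group H]

theorem twist_mem_dual (χ : H →* Circle) {c : RepClass H} (hc : c ∈ dual H) :
    twist χ c ∈ dual H := by
  obtain ⟨ρ, hρ, rfl⟩ := hc
  exact ⟨_, hρ.twist χ, rfl⟩

theorem ind_conj {N : Subgroup H} [N.Normal] [N.FiniteIndex] (g : H) (c : RepClass N) :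
    ind (conj g c) = ind c := by
  induction c using Quotient.inductionOn with
  | h ρ => exact Quotient.sound (ρ.ind_conj g).symm

theorem ind_eq_ind_iff {N : Subgroup H} [N.Normal] [N.FiniteIndex] {c c' : RepClass N}
    (hc : c ∈ dual N) (hc' : c' ∈ dual N) : ind c = ind c' ↔ ∃ g, conj g c = c' := by
  refine ⟨fun h => ?_, fun ⟨g, hg⟩ => by rw [← hg, ind_conj]⟩
  obtain ⟨ρ, hρ, rfl⟩ := hc
  obtain ⟨ρ', hρ', rfl⟩ := hc'
  obtain ⟨g, g', hg⟩ := URep.exists_conj_of_ind_equivalent hρ hρ' (Quotient.exact h)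
  have h2 : conj g (⟦ρ⟧ : RepClass N) = conj g' ⟦ρ'⟧ := Quotient.sound hg
  exact ⟨g'⁻¹ * g, by rw [conj_mul, h2, ← conj_mul, inv_mul_cancel, conj_one]⟩

theorem TrivialOn.mono {A B : Set H} (hAB : A ⊆ B) {c : RepClass H} (h : TrivialOn B c) :
    TrivialOn A c := by
  induction c using Quotient.inductionOn with
  | h ρ => exact fun x hx => h x (hAB hx)

theorem TrivialOn.twist {A : Set H} {χ : H →* Circle} (hχ : ∀ x ∈ A, χ x = 1) {c : RepClass H}
    (h : TrivialOn A c) : TrivialOn A (RepClass.twist χ c) := by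
  induction c using Quotient.inductionOn with
  | h ρ =>
    intro x hx
    change (χ x : ℂ) • ρ.mat x = 1
    rw [hχ x hx, Circle.coe_one, one_smul]
    exact h x hx

theorem TrivialOn.eq_one_of_twist {A : Set H} {χ : H →* Circle} {c : RepClass H}
    (h : TrivialOn A c) (h' : TrivialOn A (RepClass.twist χ c)) : ∀ x ∈ A, χ x = 1 := by
  induction c using Quotient.inductionOn with
  | h ρ =>
    intro x hx
    have h1 : ρ.mat x = 1 := h x hx
    have h2 : (χ x : ℂ) • ρ.mat x = 1 := h' x hx
    rw [h1] at h2
    exact Circle.ext (URep.eq_one_of_smul_one_eq_one h2)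

theorem TrivialOn.conj {N : Subgroup H} [N.Normal] {A : Set N} {g : H}
    (hA : ∀ x ∈ A, (MulAut.conjNormal g⁻¹ : MulAut N) x ∈ A) {c : RepClass N}
    (h : TrivialOn A c) : TrivialOn A (RepClass.conj g c) := by
  induction c using Quotient.inductionOn with
  | h ρ => exact fun x hx => h _ (hA x hx)

end RepClass

/-! ### Central characters and characters of lattices. -/

/-- An irreducible representation acts by scalars on a central subgroup. -/
theorem URep.IsIrreducible.exists_central_character {H : Type} [Group H] {ρ : URep H}
    (hρ : ρ.IsIrreducible) (Z : Subgroup H) (hZ : ∀ z ∈ Z, ∀ h, z * h = h * z) :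
    ∃ χ : Z →* Circle, ∀ z : Z, ρ.mat z = (χ z : ℂ) • 1 := by
  have hex : ∀ z : Z, ∃ c : Circle, ρ.mat z = (c : ℂ) • 1 := by
    intro z
    obtain ⟨c, hc⟩ := hρ.exists_eq_smul_one (ρ.mat z) fun g => by
      rw [← URep.mat_mul, ← URep.mat_mul, hZ z z.2]
    have h1 : ρ.mat z * (ρ.mat z)ᴴ = 1 := by
      rw [← URep.mat_inv, ← URep.mat_mul, mul_inv_cancel, URep.mat_one]
    rw [hc, Matrix.conjTranspose_smul, Matrix.conjTranspose_one, Matrix.smul_mul, Matrix.mul_smul,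
      Matrix.mul_one, smul_smul] at h1
    have h2 : c * star c = 1 := URep.eq_one_of_smul_one_eq_one h1
    refine ⟨⟨c, mem_sphere_zero_iff_norm.2 ?_⟩, hc⟩
    have h3 : Complex.normSq c = 1 := by
      rw [Complex.star_def, Complex.mul_conj] at h2
      exact_mod_cast h2
    rw [Complex.norm_def, h3, Real.sqrt_one]
  choose χ hχ using hex
  -- As the dimension is positive, a scalar is determined by its scalar matrix; this makes the
  -- pointwise choice `χ` multiplicative.
  have huniq : ∀ a b : ℂ, (a • 1 : Matrix (Fin ρ.dim) (Fin ρ.dim) ℂ) = b • 1 → a = b := by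
    intro a b h
    simpa using congrFun (congrFun h ⟨0, ρ.dim_pos⟩) ⟨0, ρ.dim_pos⟩
  refine ⟨⟨⟨χ, Circle.ext (huniq _ _ ?_)⟩, fun z w => Circle.ext (huniq _ _ ?_)⟩, hχ⟩
  · rw [← hχ, Subgroup.coe_one, URep.mat_one, Circle.coe_one, one_smul]
  · rw [← hχ, Subgroup.coe_mul, URep.mat_mul, hχ, hχ, Circle.coe_mul, Matrix.smul_mul,
      Matrix.mul_smul, Matrix.mul_one, smul_smul]

/-- Every character of a lattice has the form `x ↦ exp(2πi⟨l, x⟩)`. -/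
theorem exists_forall_eq_exp_inner {E : Type*} [NormedAddCommGroup E] [InnerProductSpace ℝ E]
    [FiniteDimensional ℝ E] (L : Submodule ℤ E) [DiscreteTopology L] [IsZLattice ℝ L]
    (φ : L →+ Additive Circle) :
    ∃ l : E, ∀ x : L, (φ x).toMul = Circle.exp (2 * Real.pi * inner ℝ l (x : E)) := by
  have : Module.Free ℤ L := ZLattice.module_free ℝ L
  let b := Module.Free.chooseBasis ℤ L
  let B := b.ofZLatticeBasis ℝ L
  -- A `ℤ`-basis of the lattice is an `ℝ`-basis of `E`, so the phases of `φ` on it extend to a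
  -- linear functional, which the Riesz representation turns into `l`.
  let f : E →ₗ[ℝ] ℝ :=
    B.constr ℝ fun i => Complex.arg ((φ (b i)).toMul : ℂ) / (2 * Real.pi)
  let l : E := (InnerProductSpace.toDual ℝ E).symm (LinearMap.toContinuousLinearMap f)
  have hl : ∀ x, inner ℝ l x = f x := fun x => by
    rw [InnerProductSpace.toDual_symm_apply]; rfl
  let ψ : L →+ Additive Circle :=
    { toFun := fun x => Additive.ofMul (Circle.exp (2 * Real.pi * inner ℝ l (x : E)))
      map_zero' := by simp
      map_add' := fun x y => by
        rw [Submodule.coe_add, inner_add_right, mul_add, Circle.exp_add, ofMul_mul] }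
  have hφψ : φ.toIntLinearMap = ψ.toIntLinearMap := by
    refine b.ext fun i => ?_
    have h1 : f (b i : E) = Complex.arg ((φ (b i)).toMul : ℂ) / (2 * Real.pi) := by
      rw [← b.ofZLatticeBasis_apply ℝ L i]
      exact B.constr_basis ℝ _ i
    change φ (b i) = Additive.ofMul (Circle.exp (2 * Real.pi * inner ℝ l (b i : E)))
    rw [hl, h1, mul_div_cancel₀ _ Real.two_pi_pos.ne', Circle.exp_arg]
    rfl
  exact ⟨l, fun x => congrArg Additive.toMul (LinearMap.congr_fun hφψ x)⟩

/-! ### The translation lattice, the sets `T^n` and the characters `χ_k`. -/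

namespace DiscreteIsometryGroup

variable {d₁ d₂ : ℕ} (D : DiscreteIsometryGroup d₁ d₂)

theorem mk_one_mul (x y : EuclideanSpace ℝ (Fin d₂)) :
    (⟨1, x⟩ * ⟨1, y⟩ : Euc d₂) = ⟨1, x + y⟩ :=
  EuclideanIsometry.ext (one_mul _) (by rw [trans_mul, mulVec_one])

/-- The lattice of translation vectors as a `ℤ`-submodule. -/
def lattice : Submodule ℤ (EuclideanSpace ℝ (Fin d₂)) :=
  AddSubgroup.toIntSubmodule
    { carrier := {x | (⟨1, x⟩ : Euc d₂) ∈ D.S}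
      zero_mem' := D.S.one_mem
      add_mem' := fun {x y} hx hy => by
        have h := D.S.mul_mem hx hy
        rwa [mk_one_mul] at h
      neg_mem' := fun {x} hx => by
        have h := D.S.inv_mem hx
        have e : (⟨1, x⟩ : Euc d₂)⁻¹ = ⟨1, -x⟩ :=
          EuclideanIsometry.ext inv_one (by rw [trans_inv, inv_one, mulVec_one])
        rwa [e] at h }

theorem mem_lattice {x : EuclideanSpace ℝ (Fin d₂)} :
    x ∈ D.lattice ↔ (⟨1, x⟩ : Euc d₂) ∈ translationSubgroup D.S :=
  ⟨fun h => ⟨h, rfl⟩, fun h => h.1⟩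

instance : DiscreteTopology D.lattice := by
  have := D.isSpaceGroup.discrete
  refine DiscreteTopology.of_continuous_injective
    (f := fun x : D.lattice => (⟨⟨1, x.1⟩, x.2⟩ : D.S)) ?_ ?_
  · refine Continuous.subtype_mk (continuous_induced_rng.2 ?_) _
    exact continuous_const.prodMk continuous_subtype_val
  · intro x y hxy
    exact Subtype.ext (congrArg (fun z : D.S => z.1.trans) hxy)

instance : IsZLattice ℝ D.lattice where
  span_top := by
    obtain ⟨t, ht, hli⟩ := D.isSpaceGroup.exists_translations
    rw [eq_top_iff, ← hli.span_eq_top_of_card_eq_finrank' (by simp)]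
    refine Submodule.span_mono ?_
    rintro _ ⟨i, rfl⟩
    refine D.mem_lattice.2 ?_
    have e : (⟨1, (t i).trans⟩ : Euc d₂) = t i :=
      EuclideanIsometry.ext (show 1 = (t i).rot from (ht i).2.symm) rfl
    rw [e]
    exact ht i

theorem rot_pi_of_mem_T {t : D.G} (ht : t ∈ D.T) : (D.pi t).rot = 1 :=
  (D.bijOn_pi.mapsTo ht).2

theorem exists_mem_T {x : EuclideanSpace ℝ (Fin d₂)} (hx : x ∈ D.lattice) :
    ∃ t ∈ D.T, D.pi t = ⟨1, x⟩ :=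
  D.bijOn_pi.surjOn (D.mem_lattice.1 hx)

theorem trans_pi_mem_lattice {g : D.G} (hg : g ∈ D.TF) : (D.pi g).trans ∈ D.lattice := by
  have e : (⟨1, (D.pi g).trans⟩ : Euc d₂) = D.pi g :=
    EuclideanIsometry.ext (D.mem_TF.1 hg).symm rfl
  rw [mem_lattice, e]
  exact ⟨D.pi_mem g, D.mem_TF.1 hg⟩

theorem mem_L {x : EuclideanSpace ℝ (Fin d₂)} : x ∈ D.L ↔ x ∈ D.lattice := by
  constructor
  · rintro ⟨g, hg, rfl⟩
    have e : (⟨1, g.trans⟩ : Euc d₂) = g :=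
      EuclideanIsometry.ext (show 1 = g.rot from hg.2.symm) rfl
    rw [mem_lattice, e]
    exact hg
  · exact fun hx => ⟨_, D.mem_lattice.1 hx, rfl⟩

theorem mk_one_pow (x : EuclideanSpace ℝ (Fin d₂)) (n : ℕ) :
    (⟨1, x⟩ : Euc d₂) ^ n = ⟨1, (n : ℝ) • x⟩ := by
  induction n with
  | zero => rw [pow_zero, Nat.cast_zero, zero_smul]; rfl
  | succ n ih => rw [pow_succ, ih, mk_one_mul, Nat.cast_succ, add_smul, one_smul]

theorem pi_pow_of_mem_TF {g : D.G} (hg : g ∈ D.TF) (n : ℕ) :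
    D.pi (g ^ n) = ⟨1, (n : ℝ) • (D.pi g).trans⟩ := by
  rw [map_pow, ← mk_one_pow]
  congr 1
  exact EuclideanIsometry.ext (D.mem_TF.1 hg) rfl

theorem mem_TF_of_mem_T {t : D.G} (ht : t ∈ D.T) : t ∈ D.TF :=
  D.mem_TF.2 (D.rot_pi_of_mem_T ht)

/-- `π` is injective on `T`, and multiplication by `n > 0` is injective on translation vectors.
Elements of `T^n` can therefore be compared through their translations. -/
theorem injOn_pi_powT {n : ℕ} (hn : 0 < n) : Set.InjOn D.pi (D.powT n) := by
  rintro _ ⟨t, ht, rfl⟩ _ ⟨s, hs, rfl⟩ h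
  simp only at h ⊢
  rw [D.pi_pow_of_mem_TF (D.mem_TF_of_mem_T ht), D.pi_pow_of_mem_TF (D.mem_TF_of_mem_T hs)] at h
  have h1 : (n : ℝ) • (D.pi t).trans = (n : ℝ) • (D.pi s).trans :=
    congrArg EuclideanIsometry.trans h
  have h2 := smul_right_injective _ (Nat.cast_ne_zero.2 hn.ne' : (n : ℝ) ≠ 0) h1
  rw [D.bijOn_pi.injOn ht hs (EuclideanIsometry.ext
    ((D.rot_pi_of_mem_T ht).trans (D.rot_pi_of_mem_T hs).symm) h2)]

theorem conj_mem_powT {n : ℕ} (hn : n ∈ D.M) (g : D.G) {z : D.G} (hz : z ∈ D.powT n) :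
    g * z * g⁻¹ ∈ D.powT n := by
  obtain ⟨-, N, hN, hNn⟩ := hn
  rw [← hNn] at hz ⊢
  exact hN.conj_mem z hz g

theorem pi_mul_comm {g h : D.G} (hg : g ∈ D.TF) (hh : h ∈ D.TF) :
    D.pi (g * h) = D.pi (h * g) := by
  rw [mem_TF] at hg hh
  rw [map_mul, map_mul]
  refine EuclideanIsometry.ext ?_ ?_
  · rw [rot_mul, rot_mul, hg, hh]
  · rw [trans_mul, trans_mul, hg, hh, mulVec_one, mulVec_one, add_comm]

/-- If `T^n` is a normal subgroup, then it is central in `TF`. -/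
theorem mul_comm_of_mem_powT {n : ℕ} (hn : n ∈ D.M) {z h : D.G} (hz : z ∈ D.powT n)
    (hh : h ∈ D.TF) : z * h = h * z := by
  -- The conjugate stays in `T^n` by normality and has the same image under `π`, because
  -- translations commute.
  have h1 : h * z * h⁻¹ = z := by
    refine D.injOn_pi_powT hn.1 (D.conj_mem_powT hn h hz) hz ?_
    rw [map_mul, D.pi_mul_comm hh (D.powT_subset_TF n hz), ← map_mul, mul_inv_cancel_right]
  exact (mul_inv_eq_iff_eq_mul.1 h1).symm

theorem chi_apply (k : EuclideanSpace ℝ (Fin d₂)) (h : D.TF) :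
    D.chi k h = Circle.exp (2 * Real.pi * inner ℝ k ((D.pi h).trans)) := rfl

/-- An irreducible representation of `TF` becomes trivial on the normal subgroup `T^m` after
multiplication by a suitable `χ_l`. -/
theorem exists_trivialOn_chiMul {m : ℕ} (hm : m ∈ D.M) {c : RepClass D.TF}
    (hc : c ∈ RepClass.dual D.TF) :
    ∃ l, RepClass.TrivialOn {h : D.TF | (h : D.G) ∈ D.powT m} (D.chiMul l c) := by
  obtain ⟨ρ, hρ, rfl⟩ := hc
  obtain ⟨N, -, hNm⟩ := hm.2
  have hmem : ∀ z, z ∈ N ↔ z ∈ D.powT m := fun z => by rw [← hNm]; rfl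
  obtain ⟨χ, hχ⟩ := hρ.exists_central_character (N.subgroupOf D.TF) fun z hz h =>
    Subtype.ext (D.mul_comm_of_mem_powT hm ((hmem _).1 hz) h.2)
  -- Each `x ∈ L` has a lift in `T^m` with translation `m x`. Since `T^m` is a group on which `π` is
  -- injective, lifting is additive, and the central character becomes a character `φ` of `L`.
  have hex : ∀ x : D.lattice, ∃ z : N.subgroupOf D.TF,
      D.pi ((z : D.TF) : D.G) = ⟨1, (m : ℝ) • (x : EuclideanSpace ℝ (Fin d₂))⟩ := by
    intro x
    obtain ⟨t, ht, hx⟩ := D.exists_mem_T x.2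
    refine ⟨⟨⟨t ^ m, D.TF.pow_mem (D.mem_TF_of_mem_T ht) m⟩, (hmem _).2 ⟨t, ht, rfl⟩⟩, ?_⟩
    change D.pi (t ^ m) = _
    rw [D.pi_pow_of_mem_TF (D.mem_TF_of_mem_T ht), hx]
  choose τ hτ using hex
  have hinj : ∀ z w : N.subgroupOf D.TF, D.pi ((z : D.TF) : D.G) = D.pi ((w : D.TF) : D.G) →
      z = w := fun z w h =>
    Subtype.ext (Subtype.ext (D.injOn_pi_powT hm.1 ((hmem _).1 z.2) ((hmem _).1 w.2) h))
  let φ : D.lattice →+ Additive Circle := AddMonoidHom.mk' (fun x => Additive.ofMul (χ (τ x)))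
    fun x y => by
      rw [← ofMul_mul, ← map_mul]
      refine congrArg (fun z => Additive.ofMul (χ z)) (hinj _ _ ?_)
      rw [hτ, Subgroup.coe_mul, Subgroup.coe_mul, map_mul, hτ, hτ, mk_one_mul, ← smul_add]
      rfl
  obtain ⟨l, hl⟩ := exists_forall_eq_exp_inner D.lattice φ
  have hm0 : (m : ℝ) ≠ 0 := Nat.cast_ne_zero.2 hm.1.ne'
  -- The lift of `x` has translation `m x`, whence the factor `1/m`; the sign cancels the central
  -- character.
  refine ⟨-((m : ℝ)⁻¹ • l), fun h hh => ?_⟩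
  obtain ⟨t, ht, hth⟩ := hh
  let z : N.subgroupOf D.TF := ⟨h, (hmem _).2 ⟨t, ht, hth⟩⟩
  let x : D.lattice := ⟨(D.pi t).trans, D.trans_pi_mem_lattice (D.mem_TF_of_mem_T ht)⟩
  have hpi : D.pi (h : D.G) = ⟨1, (m : ℝ) • (D.pi t).trans⟩ := by
    rw [← hth]
    exact D.pi_pow_of_mem_TF (D.mem_TF_of_mem_T ht) m
  have hz : χ z = Circle.exp (2 * Real.pi * inner ℝ l (D.pi t).trans) := by
    rw [hinj z (τ x) (hpi.trans (hτ x).symm)]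
    exact hl x
  have h1 : D.chi (-((m : ℝ)⁻¹ • l)) h * χ z = 1 := by
    rw [chi_apply, hpi, hz, ← Circle.exp_add, inner_neg_left, real_inner_smul_left,
      real_inner_smul_right, inv_mul_cancel_left₀ hm0, mul_neg, neg_add_cancel, Circle.exp_zero]
  change ((D.chi (-((m : ℝ)⁻¹ • l)) h : Circle) : ℂ) • ρ.mat h = 1
  rw [hχ z, smul_smul, ← Circle.coe_mul, h1, Circle.coe_one, one_smul]

/-- `χ_k` is trivial on `T^N` if and only if `k ∈ L*/N`. -/
theorem chi_eq_one_on_powT_iff {N : ℕ} (hN : 0 < N) (k : EuclideanSpace ℝ (Fin d₂)) :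
    (∀ h ∈ {h : D.TF | (h : D.G) ∈ D.powT N}, D.chi k h = 1) ↔ k ∈ D.dualLDiv N := by
  have hN0 : (N : ℝ) ≠ 0 := Nat.cast_ne_zero.2 hN.ne'
  constructor
  · intro h
    refine ⟨(N : ℝ) • k, fun y hy => ?_, (inv_smul_smul₀ hN0 k).symm⟩
    obtain ⟨t, ht, hty⟩ := D.exists_mem_T (D.mem_L.1 hy)
    have ht' := D.mem_TF_of_mem_T ht
    have h1 := h ⟨t ^ N, D.TF.pow_mem ht' N⟩ ⟨t, ht, rfl⟩
    rw [chi_apply, D.pi_pow_of_mem_TF ht', Circle.exp_eq_one] at h1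
    obtain ⟨n, hn⟩ := h1
    refine ⟨n, ?_⟩
    rw [hty, mul_comm, real_inner_smul_right] at hn
    rw [real_inner_smul_left]
    exact mul_right_cancel₀ Real.two_pi_pos.ne' hn
  · rintro ⟨k, hk, rfl⟩ h ⟨t, ht, hth⟩
    have ht' := D.mem_TF_of_mem_T ht
    obtain ⟨n, hn⟩ := hk _ (D.mem_L.2 (D.trans_pi_mem_lattice ht'))
    rw [chi_apply, ← hth]
    simp only
    rw [D.pi_pow_of_mem_TF ht', real_inner_smul_left, real_inner_smul_right,
      inv_mul_cancel_left₀ hN0, hn, Circle.exp_two_pi_mul_int]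

end DiscreteIsometryGroup

/-! ### Labels: orbits of `G_ρ` and the fibres of induction. -/

namespace DiscreteIsometryGroup

variable {d₁ d₂ : ℕ} (D : DiscreteIsometryGroup d₁ d₂)

theorem chiMul_mem_dual (k : EuclideanSpace ℝ (Fin d₂)) {c : RepClass D.TF}
    (hc : c ∈ RepClass.dual D.TF) : D.chiMul k c ∈ RepClass.dual D.TF :=
  RepClass.twist_mem_dual _ hc

theorem chiMul_right_inj (k : EuclideanSpace ℝ (Fin d₂)) {c c' : RepClass D.TF} :
    D.chiMul k c = D.chiMul k c' ↔ c = c' := by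
  refine ⟨fun h => ?_, fun h => by rw [h]⟩
  have := congrArg (D.chiMul (-k)) h
  rwa [chiMul_chiMul, chiMul_chiMul, neg_add_cancel, chiMul_zero, chiMul_zero] at this

theorem conj_eq_chiMul_of_chiMul_conj_eq {g : D.G} {k l : EuclideanSpace ℝ (Fin d₂)}
    {c c' : RepClass D.TF} (h : D.chiMul k (RepClass.conj g c) = D.chiMul l c') :
    RepClass.conj g c = D.chiMul (l - k) c' := by
  rwa [← D.chiMul_right_inj k, chiMul_chiMul, add_sub_cancel]

/-- Uniqueness of the representative is applied to `r` itself, which is related to `r` by `g = 1`,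
`k = 0` and to `r'` by assumption. -/
theorem eq_of_rel {R A : Set (RepClass D.TF)} (hR : D.IsRepresentationSet R A)
    {r r' : RepClass D.TF} (hr : r ∈ R) (hr' : r' ∈ R) (h : D.Rel r r') : r = r' := by
  obtain ⟨s, -, hs⟩ := hR.2 r (hR.1 hr)
  rw [hs r ⟨hr, 1, 0, by rw [RepClass.conj_one, chiMul_zero]⟩, hs r' ⟨hr', h⟩]

/-- Two elements of the families `χ_k r`, `r ∈ R`, induce the same representation if and only if
they carry the same label. -/
theorem ind_chiMul_eq_iff {R A : Set (RepClass D.TF)} (hR : D.IsRepresentationSet R A)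
    (hA : A ⊆ RepClass.dual D.TF) {r r' : RepClass D.TF} (hr : r ∈ R) (hr' : r' ∈ R)
    (k k' : EuclideanSpace ℝ (Fin d₂)) :
    RepClass.ind (D.chiMul k r) = RepClass.ind (D.chiMul k' r') ↔
      r = r' ∧ MulAction.orbit (D.Grho r) k = MulAction.orbit (D.Grho r) k' := by
  rw [RepClass.ind_eq_ind_iff (D.chiMul_mem_dual k (hA (hR.1 hr)))
    (D.chiMul_mem_dual k' (hA (hR.1 hr')))]
  constructor
  · rintro ⟨g, hg⟩
    rw [conj_chiMul] at hg
    have h := D.conj_eq_chiMul_of_chiMul_conj_eq hg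
    obtain rfl := D.eq_of_rel hR hr hr' ⟨g, _, h⟩
    -- The translation part is chosen so that this element of `G_r` sends `k` to `k'`.
    refine ⟨rfl, (MulAction.orbit_eq_iff.2
      ⟨⟨⟨(D.pi g).rot, k' - mulVec (D.pi g).rot k⟩, g, _, h, rfl⟩, ?_⟩).symm⟩
    exact add_sub_cancel _ _
  · rintro ⟨rfl, h⟩
    obtain ⟨⟨_, g, l, hg, rfl⟩, hx⟩ := MulAction.orbit_eq_iff.1 h.symm
    refine ⟨g, ?_⟩
    have hx' : mulVec (D.pi g).rot k + l = k' := hx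
    rw [conj_chiMul, hg, chiMul_chiMul, hx']

/-- The map is built by choosing a point in each orbit. `ind_chiMul_eq_iff` gives both independence
of that choice and injectivity, so only invariance, landing in the target and surjectivity remain to
be supplied. -/
theorem labelsInduced_of_forall {R A₀ X A} (hR : D.IsRepresentationSet R A₀)
    (hA₀ : A₀ ⊆ RepClass.dual D.TF)
    (hX : ∀ ρ ∈ R, ∀ g ∈ D.Grho ρ, ∀ k ∈ X, g • k ∈ X)
    (hXA : ∀ ρ ∈ R, ∀ k ∈ X, D.chiMul k ρ ∈ A)
    (hAX : ∀ a ∈ A, ∃ ρ ∈ R, ∃ k ∈ X, RepClass.ind (D.chiMul k ρ) = RepClass.ind a) :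
    D.LabelsInduced R X A := by
  refine ⟨hX, ?_⟩
  have hex : ∀ s : (Σ ρ : R, D.orbitSpace ρ X), ∃ k ∈ X,
      MulAction.orbit (D.Grho s.1) k = (s.2 : Set (EuclideanSpace ℝ (Fin d₂))) := fun s => s.2.2
  choose κ hκX hκ using hex
  refine ⟨fun s => ⟨RepClass.ind (D.chiMul (κ s) s.1), _, hXA _ s.1.2 _ (hκX s), rfl⟩, ?_, ?_, ?_⟩
  · intro ρ k hk
    exact (D.ind_chiMul_eq_iff hR hA₀ ρ.2 ρ.2 _ _).2
      ⟨rfl, hκ ⟨ρ, ⟨_, Set.mem_image_of_mem _ hk⟩⟩⟩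
  · rintro ⟨⟨r, hr⟩, o⟩ ⟨⟨r', hr'⟩, o'⟩ h
    obtain ⟨hrr, ho⟩ := (D.ind_chiMul_eq_iff hR hA₀ hr hr' _ _).1 (congrArg Subtype.val h)
    subst hrr
    have hoo : o = o' := Subtype.ext ((hκ ⟨⟨r, hr⟩, o⟩).symm.trans (ho.trans (hκ ⟨⟨r, hr⟩, o'⟩)))
    rw [hoo]
  · rintro ⟨_, a, ha, rfl⟩
    obtain ⟨ρ, hρ, k, hk, h⟩ := hAX a ha
    refine ⟨⟨⟨ρ, hρ⟩, ⟨_, Set.mem_image_of_mem _ hk⟩⟩, Subtype.ext ?_⟩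
    exact ((D.ind_chiMul_eq_iff hR hA₀ hρ hρ _ _).2
      ⟨rfl, hκ ⟨⟨ρ, hρ⟩, ⟨_, Set.mem_image_of_mem _ hk⟩⟩⟩).trans h

/-- Since `t^(mn) = (t^m)^n`, closure of the subgroup `T^m` under powers suffices. -/
theorem powT_mul_subset {m : ℕ} (hm : m ∈ D.M) (n : ℕ) : D.powT (m * n) ⊆ D.powT m := by
  obtain ⟨-, N, -, hN⟩ := hm
  rintro _ ⟨t, ht, rfl⟩
  have h : t ^ m ∈ (N : Set D.G) := by rw [hN]; exact ⟨t, ht, rfl⟩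
  rw [← hN]
  simp only [pow_mul]
  exact N.pow_mem h n

theorem trivialOn_powT_mono {m N : ℕ} (h : D.powT N ⊆ D.powT m) {c : RepClass D.TF}
    (hc : RepClass.TrivialOn {h : D.TF | (h : D.G) ∈ D.powT m} c) :
    RepClass.TrivialOn {h : D.TF | (h : D.G) ∈ D.powT N} c :=
  hc.mono (Set.preimage_mono (f := ((↑) : D.TF → D.G)) h)

theorem trivialOn_conj {N : ℕ} (hN : N ∈ D.M) (g : D.G) {c : RepClass D.TF}
    (hc : RepClass.TrivialOn {h : D.TF | (h : D.G) ∈ D.powT N} c) :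
    RepClass.TrivialOn {h : D.TF | (h : D.G) ∈ D.powT N} (RepClass.conj g c) :=
  hc.conj fun x hx => by
    change ((MulAut.conjNormal g⁻¹ : MulAut D.TF) x : D.G) ∈ D.powT N
    rw [MulAut.conjNormal_apply]
    exact D.conj_mem_powT hN g⁻¹ hx

theorem trivialOn_chiMul_iff {N : ℕ} (hN : 0 < N) {c : RepClass D.TF}
    (hc : RepClass.TrivialOn {h : D.TF | (h : D.G) ∈ D.powT N} c)
    (k : EuclideanSpace ℝ (Fin d₂)) :
    RepClass.TrivialOn {h : D.TF | (h : D.G) ∈ D.powT N} (D.chiMul k c) ↔ k ∈ D.dualLDiv N := by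
  rw [← D.chi_eq_one_on_powT_iff hN]
  exact ⟨fun h => hc.eq_one_of_twist h, fun h => hc.twist h⟩

/-- No lattice computation is needed: `k ∈ L*/N` means that `χ_k ρ` is trivial on `T^N`, a property
preserved by conjugation because `T^N` is normal, and the conjugate is `χ_{x • k} ρ`. -/
theorem smul_mem_dualLDiv {N : ℕ} (hN : N ∈ D.M) {ρ : RepClass D.TF}
    (hρ : RepClass.TrivialOn {h : D.TF | (h : D.G) ∈ D.powT N} ρ) {x : Euc d₂}
    (hx : x ∈ D.Grho ρ) {k : EuclideanSpace ℝ (Fin d₂)} (hk : k ∈ D.dualLDiv N) :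
    x • k ∈ D.dualLDiv N := by
  obtain ⟨g, l, hg, rfl⟩ := hx
  have h1 := D.trivialOn_conj hN g ((D.trivialOn_chiMul_iff hN.1 hρ k).2 hk)
  rw [conj_chiMul, hg, chiMul_chiMul] at h1
  exact (D.trivialOn_chiMul_iff hN.1 hρ _).1 h1

/-- Every representation in the dual space that is trivial on `T^N` induces the same representation
as `χ_k ρ` for some `ρ ∈ R` and `k ∈ L*/N`. -/
theorem exists_ind_chiMul_eq {m N : ℕ} (hm : m ∈ D.M) (hN : N ∈ D.M)
    (hmN : D.powT N ⊆ D.powT m) {R : Set (RepClass D.TF)}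
    (hR : D.IsRepresentationSet R (D.periodicDual m)) {a : RepClass D.TF}
    (ha : a ∈ D.periodicDual N) :
    ∃ ρ ∈ R, ∃ k ∈ D.dualLDiv N, RepClass.ind (D.chiMul k ρ) = RepClass.ind a := by
  -- `R` only represents classes trivial on `T^m`, so `a` is first twisted into that set. From `g ·
  -- (χ_l a) = χ_j r` the twist is moved across, giving `g · a = χ_k r` with `k = j - rot(π(g)) l`.
  obtain ⟨l, hl⟩ := D.exists_trivialOn_chiMul hm ha.1
  obtain ⟨r, ⟨hr, g, j, hg⟩, -⟩ := hR.2 _ ⟨D.chiMul_mem_dual l ha.1, hl⟩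
  rw [conj_chiMul] at hg
  have h := D.conj_eq_chiMul_of_chiMul_conj_eq hg
  refine ⟨r, hr, _, ?_, by rw [← h, RepClass.ind_conj]⟩
  -- Both `r` and `g · a = χ_k r` are trivial on `T^N`, which forces `k ∈ L*/N`.
  rw [← D.trivialOn_chiMul_iff hN.1 (D.trivialOn_powT_mono hmN (hR.1 hr).2), ← h]
  exact D.trivialOn_conj hN g ha.2

end DiscreteIsometryGroup

end

/-! ### The two bijections. -/

theorem mainTheorem3 {d₁ d₂ : ℕ} (D : DiscreteIsometryGroup d₁ d₂)
    (m : ℕ) (hm : D.M = {N : ℕ | ∃ n : ℕ, 0 < n ∧ N = m * n})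
    (R : Set (RepClass D.TF)) (hR : D.IsRepresentationSet R (D.periodicDual m)) :
    D.LabelsInduced R {x | ∃ N ∈ D.M, x ∈ D.dualLDiv N} {ρ | ∃ N ∈ D.M, ρ ∈ D.periodicDual N} ∧
    ∀ N ∈ D.M, D.LabelsInduced R (D.dualLDiv N) (D.periodicDual N) := by
  have hmM : m ∈ D.M := by rw [hm]; exact ⟨1, one_pos, (mul_one m).symm⟩
  -- Divisibility of every `N ∈ M_0` by `m` lets the single set `R` serve all `N`.
  have hsub : ∀ N ∈ D.M, D.powT N ⊆ D.powT m := fun N hN => by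
    rw [hm] at hN
    obtain ⟨n, -, rfl⟩ := hN
    exact D.powT_mul_subset hmM n
  have hdual : D.periodicDual m ⊆ RepClass.dual D.TF := fun _ h => h.1
  have htriv : ∀ N ∈ D.M, ∀ ρ ∈ R,
      RepClass.TrivialOn {h : D.TF | (h : D.G) ∈ D.powT N} ρ := fun N hN ρ hρ =>
    D.trivialOn_powT_mono (hsub N hN) (hR.1 hρ).2
  have hmem : ∀ N ∈ D.M, ∀ ρ ∈ R, ∀ k ∈ D.dualLDiv N, D.chiMul k ρ ∈ D.periodicDual N :=
    fun N hN ρ hρ k hk => ⟨D.chiMul_mem_dual k (hdual (hR.1 hρ)),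
      (D.trivialOn_chiMul_iff hN.1 (htriv N hN ρ hρ) k).2 hk⟩
  refine ⟨D.labelsInduced_of_forall hR hdual ?_ ?_ ?_, fun N hN =>
    D.labelsInduced_of_forall hR hdual
      (fun ρ hρ g hg k hk => D.smul_mem_dualLDiv hN (htriv N hN ρ hρ) hg hk) (hmem N hN)
      fun a ha => D.exists_ind_chiMul_eq hmM hN (hsub N hN) hR ha⟩
  -- In (i) both the label set and the set of representations are unions over `N ∈ M_0`, so each
  -- condition is checked at one `N`.
  · rintro ρ hρ g hg k ⟨N, hN, hk⟩
    exact ⟨N, hN, D.smul_mem_dualLDiv hN (htriv N hN ρ hρ) hg hk⟩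
  · rintro ρ hρ k ⟨N, hN, hk⟩
    exact ⟨N, hN, hmem N hN ρ hρ k hk⟩
  · rintro a ⟨N, hN, ha⟩
    obtain ⟨ρ, hρ, k, hk, h⟩ := D.exists_ind_chiMul_eq hmM hN (hsub N hN) hR ha
    exact ⟨ρ, hρ, k, ⟨N, hN, hk⟩, h⟩
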